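/- For integers $s_1,\dots,s_l\ge 1$ let $$[s_1,\dots,s_l]=\frac{1}{(s_1-1)!\cdots(s_l-1)!}\sum_{n>0}\Big(\sum_{\substack{u_1v_1+\dots+u_lv_l=n\\ u_1>\dots>u_l>0,\ v_j>0}}v_1^{s_1-1}\cdots v_l^{s_l-1}\Big)q^n\in\mathbb{Q}[[q]]$$ if $l>0$, and let $[\emptyset]=1$. We call $[s_1,\dots,s_l]$ a bracket of weight $s_1+\dots+s_l$, and call it admissible if $l=0$ or $s_1>1$. For $k\ge 0$ let $\mathrm{Fil}^W_k(\mathcal{MD})$ (respectively $\mathrm{Fil}^W_k(\mathcal{MDA})$) be the $\mathbb{Q}$-span of all brackets (respectively all admissible brackets) of weight at most $k$; for $k<0$ these spaces are $0$. Let $\mathrm{d}=q\frac{d}{dq}$. Then, for every $j\ge 0$, each $g\in\mathrm{Fil}^W_j(\mathcal{MDA})$ converges for real $q\in(0,1)$, and the limit $Z_j(g)=\lim_{q\to1^-}(1-q)^j g(q)\in\mathbb{R}$ exists. Moreover, for every $k\ge0$, the space $\mathrm{Fil}^W_k(\mathcal{MD})$ is exactly the set of all sums $\sum_{j=0}^k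 g_j[1]^{k-j}$ with $g_j\in\mathrm{Fil}^W_j(\mathcal{MDA})$, and $$Z_k^{alg}\Big(\sum_{j=0}^k g_j[1]^{k-j}\Big)=\sum_{j=0}^k Z_j(g_j)\,T^{k-j}$$ gives a well-defined $\mathbb{Q}$-linear map $Z_k^{alg}:\mathrm{Fil}^W_k(\mathcal{MD})\to\mathbb{R}[T]$. For the kernel $\ker Z_k^{alg}\subseteq \mathrm{Fil}^W_k(\mathcal{MD})$ the following hold. (i) If $s_1+\dots+s_l<k$, then $[s_1,\dots,s_l]\in\ker Z_k^{alg}$. (ii) $\mathrm{d}\,\mathrm{Fil}^W_{k-2}(\mathcal{MD})\subseteq\ker Z_k^{alg}$. (iii) If $f\in\mathbb{Q}[[q]]$ is the Fourier expansion of a cusp form of weight $k$ for $\mathrm{SL}_2(\mathbb{Z})$, then $f\in\ker Z_k^{alg}$ (in particular $f\in\mathrm{Fil}^W_k(\mathcal{MD})$). -/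

import Mathlib

open Filter Topology
open scoped MatrixGroups

noncomputable section

/-- The multiple divisor sum `σ_{r_1,…,r_l}(n)`: the sum of `v_1^{r_1} ⋯ v_l^{r_l}` over all positive
integers `u_j`, `v_j` with `u_1 > ⋯ > u_l > 0` and `u_1 v_1 + ⋯ + u_l v_l = n`.
(Every such `u_j` and `v_j` lies between `1` and `n`.) -/
def multipleDivisorSum {l : ℕ} (r : Fin l → ℕ) (n : ℕ) : ℕ :=
  ∑ p ∈ (Fintype.piFinset (fun _ : Fin l => Finset.Icc 1 n) ×ˢ
        Fintype.piFinset (fun _ : Fin l => Finset.Icc 1 n)).filter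
      (fun p => (∀ i j : Fin l, i < j → p.1 j < p.1 i) ∧ ∑ j, p.1 j * p.2 j = n),
    ∏ j, p.2 j ^ r j

/-- The bracket `[s_1,…,s_l] ∈ ℚ⟦q⟧` (meant for positive `s_j`).  For `l > 0` the constant term is
`0`, and for `l = 0` this is `[∅] = 1`, see `bracket_empty`. -/
def bracket {l : ℕ} (s : Fin l → ℕ) : PowerSeries ℚ :=
  PowerSeries.mk fun n =>
    (multipleDivisorSum (fun j => s j - 1) n : ℚ) / ∏ j, ((s j - 1).factorial : ℚ)

theorem bracket_empty (s : Fin 0 → ℕ) : bracket s = 1 := by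
  ext n
  rw [bracket, PowerSeries.coeff_mk, PowerSeries.coeff_one]
  rcases Nat.eq_zero_or_pos n with rfl | h
  · simp [multipleDivisorSum]
  · simp [multipleDivisorSum, h.ne, h.ne']

/-- `Fil^W_k(MD)`: the `ℚ`-span of all brackets of weight at most `k` (including `[∅] = 1`). -/
def FilMD (k : ℕ) : Submodule ℚ (PowerSeries ℚ) :=
  Submodule.span ℚ {f | ∃ (l : ℕ) (s : Fin l → ℕ),
    (∀ j, 1 ≤ s j) ∧ ∑ j, s j ≤ k ∧ f = bracket s}

/-- `Fil^W_k(MDA)`: the `ℚ`-span of all admissible brackets of weight at most `k`, where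
`[s_1,…,s_l]` is admissible if `s_1 > 1` (and `[∅] = 1` is admissible). -/
def FilMDA (k : ℕ) : Submodule ℚ (PowerSeries ℚ) :=
  Submodule.span ℚ {f | ∃ (l : ℕ) (s : Fin l → ℕ),
    (∀ j, 1 ≤ s j) ∧ (∀ h : 0 < l, 1 < s ⟨0, h⟩) ∧ ∑ j, s j ≤ k ∧ f = bracket s}

/-- The bracket `[1]`. -/
def bracketOne : PowerSeries ℚ := bracket (fun _ : Fin 1 => 1)

/-- The derivation `d = q d/dq`. -/
def qDeriv (f : PowerSeries ℚ) : PowerSeries ℚ := PowerSeries.X * PowerSeries.derivative ℚ f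

/-- The value at a real number `q` of a power series with rational coefficients. -/
def qEval (f : PowerSeries ℚ) (q : ℝ) : ℝ := ∑' n : ℕ, ((PowerSeries.coeff n f : ℚ) : ℝ) * q ^ n

/-- `Z_k(f) = lim_{q → 1} (1 - q)^k f(q)`, with `q` in `(0,1)`. -/
def Zmap (k : ℕ) (f : PowerSeries ℚ) : ℝ :=
  limUnder (𝓝[<] (1 : ℝ)) (fun q : ℝ => (1 - q) ^ k * qEval f q)

/-- The family `(g_j)_{j ≤ k}` expresses `f` as `∑_{j ≤ k} g_j [1]^{k-j}` with
`g_j ∈ Fil^W_j(MDA)`. -/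
def IsExpansion (k : ℕ) (f : PowerSeries ℚ) (g : ℕ → PowerSeries ℚ) : Prop :=
  (∀ j ≤ k, g j ∈ FilMDA j) ∧ f = ∑ j ∈ Finset.range (k + 1), g j * bracketOne ^ (k - j)

/-- The polynomial `∑_{j ≤ k} Z_j(g_j) T^{k-j}`. -/
def expansionPoly (k : ℕ) (g : ℕ → PowerSeries ℚ) : Polynomial ℝ :=
  ∑ j ∈ Finset.range (k + 1), Polynomial.C (Zmap j (g j)) * Polynomial.X ^ (k - j)

open Classical in
/-- The map `Z_k^alg : Fil^W_k(MD) → ℝ[T]`, sending `∑_{j ≤ k} g_j [1]^{k-j}` with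
`g_j ∈ Fil^W_j(MDA)` to `∑_{j ≤ k} Z_j(g_j) T^{k-j}`. -/
def Zalg (k : ℕ) (f : FilMD k) : Polynomial ℝ :=
  if h : ∃ g, IsExpansion k (f : PowerSeries ℚ) g then expansionPoly k h.choose else 0

/-- The kernel of `Z_k^alg`, as a subset of `Fil^W_k(MD)`. -/
def kerZalg (k : ℕ) : Set (PowerSeries ℚ) := {f | ∃ h : f ∈ FilMD k, Zalg k ⟨f, h⟩ = 0}

/-- `f ∈ ℚ⟦q⟧` is (the Fourier expansion of) a cusp form of weight `k` for `SL₂(ℤ)`. -/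
def IsCuspFormExpansion (k : ℕ) (f : PowerSeries ℚ) : Prop :=
  ∃ F : CuspForm 𝒮ℒ (k : ℤ),
    UpperHalfPlane.qExpansion 1 F = PowerSeries.map (algebraMap ℚ ℂ) f

end

/-!
The proof compares the algebraic map `Z_k^alg` with the growth of power series as `q → 1`. Write
`e(q) = (1 - q) [1](q)`.

*Structure of the brackets.* Up to rational factors a bracket is a word in the exponents
`r_j = s_j - 1`, truncated by `u_1 ≤ N` it satisfies a recursion in `N`, and the product of two
truncated brackets splits according to the order of the two largest parts. As
`∑ v ^ a x ^ v * ∑ v ^ b x ^ v` is a combination of series of the same kind, the brackets form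
a filtered algebra (`truncBracket_mul_mem`, `FilMD_mul_mem`). Multiplying by `[1]` a word with `m`
leading ones gives `m + 1` times the word with one more, up to simpler words
(`truncBracket_zero_mul`), so that `Fil^W_k(MD)` consists of the polynomials in `[1]` over the
admissible brackets (`mem_FilMD_iff`).

*Derivation.* A bracket is a sum over partitions with `l` distinct parts `u_j` of multiplicity `v_j`.
In the coordinates `n_j = v_1 + ⋯ + v_j` of the conjugate partition its summands are products of
`e_n = q ^ n / (1 - q ^ n)` and powers of differences of the `n_j`. There
`q d/dq e_n = n e_n + n e_n ^ 2`, and the difference of `[2] * f` and `q d/dq f` is visibly a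
combination of brackets (`twoSubDeriv_tailSum`, `qDeriv_mem_FilMD`).

*Growth.* For admissible `g` of weight at most `j` one has
`(1 - q) ^ j g(q) = Z_j(g) + O(√(1 - q))` (`exists_Zmap_sub_le`), while `e(q)` tends to infinity
like `-log (1 - q)`. Hence `f = ∑ g_j [1] ^ (k - j)` satisfies
`(1 - q) ^ k f(q) = P(e(q)) + o(1)` with `P = ∑ Z_j(g_j) T ^ (k - j)`
(`isGrowthPoly_of_isExpansion`). As `e(q)` is unbounded, `P` is determined by `f`
(`IsGrowthPoly.unique`): `Z_k^alg` is well defined and linear, and `f` is in the kernel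
as soon as `(1 - q) ^ k f(q)` tends to `0` (`mem_kerZalg`).

*Elements of the kernel.* Each of the three families has this decay. For smaller weight there is a
spare factor `1 - q` against powers of the logarithm. For derivatives the value of `q d/dq f` at `q`
is bounded by the value of `f` at `√q`. A cusp form is carried by `τ ↦ -1 / τ` to a neighbourhood
of the cusp `i∞`, where it vanishes; and modular forms are combinations of brackets because
they are generated by Eisenstein series, by induction on the weight with division by `Δ`
(`qExpansion_mem_FilMDComplex`).
-/

namespace MultipleDivisorSums

open PowerSeries

/-! ### The Euler derivation and one-variable power sums -/

lemma coeff_qDeriv (f : ℚ⟦X⟧) (n : ℕ) : coeff n (qDeriv f) = n * coeff n f := by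
  cases n with
  | zero => simp [qDeriv]
  | succ n =>
    rw [qDeriv, coeff_succ_X_mul, coeff_derivative]
    push_cast
    ring

lemma qDeriv_add (f g : ℚ⟦X⟧) : qDeriv (f + g) = qDeriv f + qDeriv g := by
  simp [qDeriv, mul_add]

lemma qDeriv_smul (c : ℚ) (f : ℚ⟦X⟧) : qDeriv (c • f) = c • qDeriv f := by
  simp [qDeriv]

lemma qDeriv_mul (f g : ℚ⟦X⟧) : qDeriv (f * g) = qDeriv f * g + f * qDeriv g := by
  simp only [qDeriv, Derivation.leibniz, smul_eq_mul]
  ring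

/-- The derivation `q d/dq` as a `ℚ`-linear map. -/
noncomputable def qDerivLin : ℚ⟦X⟧ →ₗ[ℚ] ℚ⟦X⟧ where
  toFun := qDeriv
  map_add' := qDeriv_add
  map_smul' := qDeriv_smul

lemma qDerivLin_apply (f : ℚ⟦X⟧) : qDerivLin f = qDeriv f := rfl

lemma qDeriv_sum {ι : Type*} (s : Finset ι) (f : ι → ℚ⟦X⟧) :
    qDeriv (∑ i ∈ s, f i) = ∑ i ∈ s, qDeriv (f i) :=
  map_sum qDerivLin f s

/-- The power series `∑_{v ≥ 1} v ^ r X ^ v`. -/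
noncomputable def powSeries (r : ℕ) : ℚ⟦X⟧ := mk fun v => if v = 0 then 0 else (v : ℚ) ^ r

lemma coeff_powSeries (r v : ℕ) : coeff v (powSeries r) = if v = 0 then 0 else (v : ℚ) ^ r := by
  simp [powSeries]

lemma qDeriv_powSeries (r : ℕ) : qDeriv (powSeries r) = powSeries (r + 1) := by
  ext v
  rw [coeff_qDeriv, coeff_powSeries, coeff_powSeries]
  split_ifs with h
  · simp
  · ring

lemma powSeries_zero_mul : powSeries 0 * (1 - X) = X := by
  ext v
  rw [mul_sub, mul_one, map_sub]
  cases v with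
  | zero => simp [coeff_powSeries]
  | succ v =>
    rw [coeff_succ_mul_X, coeff_powSeries, coeff_powSeries, coeff_X]
    cases v <;> simp

lemma one_sub_X_ne_zero : (1 - X : ℚ⟦X⟧) ≠ 0 := by
  intro h
  have := congrArg (coeff 0) h
  simp at this

lemma qDeriv_one_sub_X : qDeriv (1 - X : ℚ⟦X⟧) = -X := by
  simp [qDeriv]

lemma qDeriv_powSeries_zero : qDeriv (powSeries 0) = powSeries 0 + powSeries 0 ^ 2 := by
  have h := congrArg qDeriv powSeries_zero_mul
  rw [qDeriv_mul, qDeriv_one_sub_X] at h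
  have hX : qDeriv (X : ℚ⟦X⟧) = X := by simp [qDeriv]
  rw [hX] at h
  apply mul_right_cancel₀ one_sub_X_ne_zero
  linear_combination h - (powSeries 0) * powSeries_zero_mul - powSeries_zero_mul

lemma qDeriv_powSeries_zero_pow (c : ℕ) : qDeriv (powSeries 0 ^ (c + 1)) =
    ((c : ℚ) + 1) • (powSeries 0 ^ (c + 1) + powSeries 0 ^ (c + 2)) := by
  rw [qDeriv, Derivation.leibniz_pow, Nat.add_sub_cancel, smul_eq_mul, nsmul_eq_mul,
    smul_eq_C_mul]
  have h := qDeriv_powSeries_zero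
  rw [qDeriv] at h
  have hc : C ((c : ℚ) + 1) = ((c + 1 : ℕ) : ℚ⟦X⟧) := by simp
  rw [hc]
  linear_combination ((c + 1 : ℕ) : ℚ⟦X⟧) * powSeries 0 ^ c * h

/-- The span of `∑_{v ≥ 1} v ^ c X ^ v` for `c < k`. -/
noncomputable def powSpan (k : ℕ) : Submodule ℚ ℚ⟦X⟧ :=
  Submodule.span ℚ {f | ∃ c < k, f = powSeries c}

/-- The span of `z, z ^ 2, …, z ^ k` for `z = X / (1 - X)`. -/
noncomputable def geomSpan (k : ℕ) : Submodule ℚ ℚ⟦X⟧ :=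
  Submodule.span ℚ {f | ∃ c < k, f = powSeries 0 ^ (c + 1)}

lemma powSpan_mono {k m : ℕ} (h : k ≤ m) : powSpan k ≤ powSpan m :=
  Submodule.span_mono fun _ ⟨c, hc, hf⟩ => ⟨c, hc.trans_le h, hf⟩

lemma powSeries_mem_powSpan {c k : ℕ} (h : c < k) : powSeries c ∈ powSpan k :=
  Submodule.subset_span ⟨c, h, rfl⟩

lemma pow_mem_geomSpan {c k : ℕ} (h : c < k) : powSeries 0 ^ (c + 1) ∈ geomSpan k :=
  Submodule.subset_span ⟨c, h, rfl⟩

lemma qDeriv_mem_powSpan {k : ℕ} {f : ℚ⟦X⟧} (hf : f ∈ powSpan k) :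
    qDeriv f ∈ powSpan (k + 1) := by
  have : powSpan k ≤ (powSpan (k + 1)).comap qDerivLin := by
    refine Submodule.span_le.mpr ?_
    rintro _ ⟨c, hc, rfl⟩
    change qDeriv _ ∈ powSpan (k + 1)
    rw [qDeriv_powSeries]
    exact powSeries_mem_powSpan (by omega)
  exact this hf

lemma qDeriv_mem_geomSpan {k : ℕ} {f : ℚ⟦X⟧} (hf : f ∈ geomSpan k) :
    qDeriv f ∈ geomSpan (k + 1) := by
  have : geomSpan k ≤ (geomSpan (k + 1)).comap qDerivLin := by
    refine Submodule.span_le.mpr ?_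
    rintro _ ⟨c, hc, rfl⟩
    change qDeriv _ ∈ geomSpan (k + 1)
    rw [qDeriv_powSeries_zero_pow]
    exact Submodule.smul_mem _ _ (add_mem (pow_mem_geomSpan (by omega))
      (pow_mem_geomSpan (c := c + 1) (by omega)))
  exact this hf

lemma powSeries_mem_geomSpan (c : ℕ) : powSeries c ∈ geomSpan (c + 1) := by
  induction c with
  | zero => simpa using pow_mem_geomSpan (c := 0) (k := 1) one_pos
  | succ c ih =>
    rw [← qDeriv_powSeries]
    exact qDeriv_mem_geomSpan ih

lemma pow_mem_powSpan (c : ℕ) : powSeries 0 ^ (c + 1) ∈ powSpan (c + 1) := by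
  induction c with
  | zero => simpa using powSeries_mem_powSpan (c := 0) (k := 1) one_pos
  | succ c ih =>
    have h : powSeries 0 ^ (c + 1 + 1) =
        ((c : ℚ) + 1)⁻¹ • qDeriv (powSeries 0 ^ (c + 1)) - powSeries 0 ^ (c + 1) := by
      rw [qDeriv_powSeries_zero_pow, inv_smul_smul₀ (by positivity), add_sub_cancel_left]
    rw [h]
    exact sub_mem (Submodule.smul_mem _ _ (qDeriv_mem_powSpan ih)) (powSpan_mono (by omega) ih)

/-- Products of power sums: `(∑ v ^ a X ^ v) (∑ v ^ b X ^ v)` is a combination of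
`∑ v ^ c X ^ v` with `c ≤ a + b + 1`. -/
lemma powSeries_mul_mem (a b : ℕ) : powSeries a * powSeries b ∈ powSpan (a + b + 2) := by
  have h : powSeries a * powSeries b ∈ geomSpan (a + 1) * geomSpan (b + 1) :=
    Submodule.mul_mem_mul (powSeries_mem_geomSpan a) (powSeries_mem_geomSpan b)
  rw [geomSpan, geomSpan, Submodule.span_mul_span] at h
  refine (Submodule.span_le.mpr ?_ :
    Submodule.span ℚ _ ≤ powSpan (a + b + 2)) h
  rintro _ ⟨_, ⟨c, hc, rfl⟩, _, ⟨d, hd, rfl⟩, rfl⟩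
  change powSeries 0 ^ (c + 1) * powSeries 0 ^ (d + 1) ∈ _
  rw [← pow_add, show c + 1 + (d + 1) = c + d + 1 + 1 by ring]
  exact powSpan_mono (by omega) (pow_mem_powSpan (c + d + 1))

/-! ### Truncated brackets and the quasi-shuffle product -/

/-- The series `∑_{v ≥ 1} v ^ r X ^ (u + 1) v`; the index `u` is one less than the part `u + 1`. -/
noncomputable def partSeries (r u : ℕ) : ℚ⟦X⟧ := expand (u + 1) u.succ_ne_zero (powSeries r)

lemma coeff_partSeries (r u n : ℕ) : coeff n (partSeries r u) =
    if u + 1 ∣ n ∧ n ≠ 0 then ((n / (u + 1) : ℕ) : ℚ) ^ r else 0 := by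
  rw [partSeries, coeff_expand, coeff_powSeries]
  by_cases h : u + 1 ∣ n
  · obtain ⟨m, rfl⟩ := h
    simp
  · simp [h]

lemma coeff_partSeries_eq_zero {r u n : ℕ} (h : n ≤ u) : coeff n (partSeries r u) = 0 := by
  rw [coeff_partSeries, if_neg]
  rintro ⟨h1, h2⟩
  have := Nat.le_of_dvd (Nat.pos_of_ne_zero h2) h1
  omega

/-- Summation against a kernel: `N ↦ ∑_{u < N} e u * F u`. -/
noncomputable def kernelSum (e : ℕ → ℚ⟦X⟧) : (ℕ → ℚ⟦X⟧) →ₗ[ℚ] (ℕ → ℚ⟦X⟧) where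
  toFun F N := ∑ u ∈ Finset.range N, e u * F u
  map_add' F G := by
    funext N
    simp [mul_add, Finset.sum_add_distrib]
  map_smul' c F := by
    funext N
    simp [Finset.smul_sum]

lemma kernelSum_apply (e F : ℕ → ℚ⟦X⟧) (N : ℕ) :
    kernelSum e F N = ∑ u ∈ Finset.range N, e u * F u := rfl

/-- Splitting a product of two sums into the parts `u > u'`, `u < u'` and `u = u'`. -/
lemma kernelSum_mul_kernelSum (e e' F G : ℕ → ℚ⟦X⟧) :
    kernelSum e F * kernelSum e' G = kernelSum e (F * kernelSum e' G) +
      kernelSum e' (kernelSum e F * G) + kernelSum (e * e') (F * G) := by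
  funext N
  simp only [Pi.mul_apply, Pi.add_apply]
  induction N with
  | zero => simp [kernelSum_apply]
  | succ N ih =>
    have hs : ∀ e F : ℕ → ℚ⟦X⟧, kernelSum e F (N + 1) = kernelSum e F N + e N * F N :=
      fun e F => by rw [kernelSum_apply, Finset.sum_range_succ, ← kernelSum_apply]
    simp only [hs, Pi.mul_apply]
    linear_combination ih

/-- The product of two kernels `partSeries a`, `partSeries b` acts through kernels
`partSeries c`, `c ≤ a + b + 1`, with coefficients that do not depend on the part. -/
lemma exists_kernelSum_partSeries_mul (a b : ℕ) : ∃ c : ℕ → ℚ, ∀ F : ℕ → ℚ⟦X⟧,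
    kernelSum (partSeries a * partSeries b) F =
      ∑ i ∈ Finset.range (a + b + 2), c i • kernelSum (partSeries i) F := by
  obtain ⟨c, hc⟩ : ∃ c : ℕ → ℚ, powSeries a * powSeries b =
      ∑ i ∈ Finset.range (a + b + 2), c i • powSeries i := by
    have h : powSpan (a + b + 2) =
        Submodule.span ℚ (powSeries '' (Finset.range (a + b + 2) : Finset ℕ)) := by
      rw [powSpan]
      congr 1
      ext f
      simp [eq_comm]
    have hm := powSeries_mul_mem a b
    rw [h, Submodule.mem_span_image_finset_iff_exists_fun] at hm
    obtain ⟨c, hc⟩ := hm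
    refine ⟨fun i => if h : i ∈ Finset.range (a + b + 2) then c ⟨i, h⟩ else 0, ?_⟩
    rw [← hc, ← Finset.sum_coe_sort (Finset.range (a + b + 2))]
    exact Finset.sum_congr rfl fun i _ => by simp only [dif_pos i.2]
  refine ⟨c, fun F => ?_⟩
  funext N
  have hp : ∀ u, partSeries a u * partSeries b u =
      ∑ i ∈ Finset.range (a + b + 2), c i • partSeries i u := by
    intro u
    rw [partSeries, partSeries, ← map_mul, hc, map_sum]
    simp_rw [map_smul, partSeries]
  simp only [kernelSum_apply, Pi.mul_apply, hp, Finset.sum_apply, Pi.smul_apply,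
    Finset.sum_mul, Finset.smul_sum, smul_mul_assoc]
  exact Finset.sum_comm

/-- The weight of a word; a letter `r` stands for the exponent `r = s - 1` and has
weight `s = r + 1`. -/
def weight (w : List ℕ) : ℕ := (w.map (· + 1)).sum

@[simp] lemma weight_nil : weight [] = 0 := rfl

@[simp] lemma weight_cons (r : ℕ) (w : List ℕ) : weight (r :: w) = r + 1 + weight w := by
  simp [weight]

/-- The truncated bracket `∑ v_1 ^ r_1 ⋯ v_l ^ r_l X ^ (u_1 v_1 + ⋯ + u_l v_l)`
over `N ≥ u_1 > ⋯ > u_l > 0` and `v_j > 0`, as a function of `N`. -/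
noncomputable def truncBracket : List ℕ → ℕ → ℚ⟦X⟧
  | [] => 1
  | r :: w => kernelSum (partSeries r) (truncBracket w)

lemma truncBracket_nil : truncBracket [] = 1 := rfl

lemma truncBracket_cons (r : ℕ) (w : List ℕ) :
    truncBracket (r :: w) = kernelSum (partSeries r) (truncBracket w) := rfl

/-- The span of the truncated brackets of weight at most `k`. -/
noncomputable def truncSpan (k : ℕ) : Submodule ℚ (ℕ → ℚ⟦X⟧) :=
  Submodule.span ℚ {F | ∃ w, weight w ≤ k ∧ F = truncBracket w}

lemma truncBracket_mem {w : List ℕ} {k : ℕ} (h : weight w ≤ k) : truncBracket w ∈ truncSpan k :=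
  Submodule.subset_span ⟨w, h, rfl⟩

lemma kernelSum_mem_truncSpan {F : ℕ → ℚ⟦X⟧} {k r m : ℕ} (hF : F ∈ truncSpan k)
    (hm : k + r + 1 ≤ m) : kernelSum (partSeries r) F ∈ truncSpan m := by
  have : truncSpan k ≤ (truncSpan m).comap (kernelSum (partSeries r)) := by
    refine Submodule.span_le.mpr ?_
    rintro _ ⟨w, hw, rfl⟩
    change kernelSum (partSeries r) (truncBracket w) ∈ truncSpan m
    rw [← truncBracket_cons]
    exact truncBracket_mem (by rw [weight_cons]; omega)
  exact this hF

/-- The quasi-shuffle product respects the weight filtration. -/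
lemma truncBracket_mul_mem (w w' : List ℕ) :
    truncBracket w * truncBracket w' ∈ truncSpan (weight w + weight w') := by
  induction w generalizing w' with
  | nil =>
    rw [truncBracket_nil, one_mul]
    exact truncBracket_mem (by simp)
  | cons a w ih =>
    induction w' with
    | nil =>
      rw [truncBracket_nil, mul_one]
      exact truncBracket_mem (by simp)
    | cons b w' ih' =>
      rw [truncBracket_cons a, truncBracket_cons b, kernelSum_mul_kernelSum,
        ← truncBracket_cons a, ← truncBracket_cons b, weight_cons, weight_cons]
      have h1 := ih (b :: w')
      rw [weight_cons] at h1
      rw [weight_cons] at ih'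
      refine add_mem (add_mem ?_ ?_) ?_
      · exact kernelSum_mem_truncSpan h1 (by omega)
      · exact kernelSum_mem_truncSpan ih' (by omega)
      · obtain ⟨c, hc⟩ := exists_kernelSum_partSeries_mul a b
        rw [hc]
        refine Submodule.sum_mem _ fun i hi => Submodule.smul_mem _ _ ?_
        rw [Finset.mem_range] at hi
        exact kernelSum_mem_truncSpan (ih w') (by omega)

/-- The number of leading letters `0`, that is of leading entries `s_j = 1`. -/
def leadingZeros : List ℕ → ℕ
  | [] => 0
  | 0 :: w => leadingZeros w + 1
  | (_ + 1) :: _ => 0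

lemma exists_eq_replicate_append (w : List ℕ) :
    ∃ w', leadingZeros w' = 0 ∧ w = List.replicate (leadingZeros w) 0 ++ w' := by
  induction w with
  | nil => exact ⟨[], rfl, rfl⟩
  | cons r w ih =>
    cases r with
    | zero =>
      obtain ⟨w', h0, h1⟩ := ih
      refine ⟨w', h0, ?_⟩
      rw [leadingZeros, List.replicate_succ, List.cons_append, ← h1]
    | succ r => exact ⟨(r + 1) :: w, rfl, rfl⟩

/-- The span of the truncated brackets of weight at most `k` which have at most `m` leading
zeros or weight less than `k`. -/
noncomputable def leadSpan (k m : ℕ) : Submodule ℚ (ℕ → ℚ⟦X⟧) :=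
  Submodule.span ℚ {F | ∃ w, weight w ≤ k ∧ (leadingZeros w ≤ m ∨ weight w < k) ∧
    F = truncBracket w}

lemma truncBracket_mem_leadSpan {w : List ℕ} {k m : ℕ} (h : weight w ≤ k)
    (h' : leadingZeros w ≤ m ∨ weight w < k) : truncBracket w ∈ leadSpan k m :=
  Submodule.subset_span ⟨w, h, h', rfl⟩

lemma kernelSum_succ_mem_leadSpan {F : ℕ → ℚ⟦X⟧} {k r n m : ℕ} (hF : F ∈ truncSpan k)
    (hm : k + r + 2 ≤ n) : kernelSum (partSeries (r + 1)) F ∈ leadSpan n m := by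
  have : truncSpan k ≤ (leadSpan n m).comap (kernelSum (partSeries (r + 1))) := by
    refine Submodule.span_le.mpr ?_
    rintro _ ⟨w, hw, rfl⟩
    change kernelSum (partSeries (r + 1)) (truncBracket w) ∈ leadSpan n m
    rw [← truncBracket_cons]
    exact truncBracket_mem_leadSpan (by rw [weight_cons]; omega) (Or.inl (Nat.zero_le _))
  exact this hF

lemma kernelSum_zero_mem_leadSpan {F : ℕ → ℚ⟦X⟧} {k m : ℕ} (hF : F ∈ leadSpan k m) :
    kernelSum (partSeries 0) F ∈ leadSpan (k + 1) (m + 1) := by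
  have : leadSpan k m ≤ (leadSpan (k + 1) (m + 1)).comap (kernelSum (partSeries 0)) := by
    refine Submodule.span_le.mpr ?_
    rintro _ ⟨w, hw, hw', rfl⟩
    change kernelSum (partSeries 0) (truncBracket w) ∈ leadSpan _ _
    rw [← truncBracket_cons]
    refine truncBracket_mem_leadSpan (by rw [weight_cons]; omega) ?_
    rw [weight_cons, leadingZeros]
    omega
  exact this hF

/-- Merging the letter `0` of `[1]` with the first letter leaves no leading zero, up to words of
smaller weight. -/
lemma kernelSum_partSeries_mul_mem_leadSpan {a m k : ℕ} {w : List ℕ}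
    (h : weight w + a + 2 ≤ k) :
    kernelSum (partSeries 0 * partSeries a) (truncBracket w) ∈ leadSpan k m := by
  obtain ⟨c, hc⟩ := exists_kernelSum_partSeries_mul 0 a
  rw [hc]
  refine Submodule.sum_mem _ fun i hi => Submodule.smul_mem _ _ ?_
  rw [Finset.mem_range] at hi
  cases i with
  | zero =>
    rw [← truncBracket_cons]
    exact truncBracket_mem_leadSpan (by rw [weight_cons]; omega)
      (Or.inr (by rw [weight_cons]; omega))
  | succ i => exact kernelSum_succ_mem_leadSpan (truncBracket_mem le_rfl) (by omega)

/-- Multiplying by `[1]` a word with `m` leading ones gives `m + 1` times the word with one more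
leading one, up to words with fewer leading ones or of smaller weight. -/
lemma truncBracket_zero_mul (m : ℕ) (w : List ℕ) (hw : leadingZeros w = 0) :
    truncBracket [0] * truncBracket (List.replicate m 0 ++ w) -
      ((m : ℚ) + 1) • truncBracket (List.replicate (m + 1) 0 ++ w) ∈
        leadSpan (weight w + m + 1) m := by
  induction m with
  | zero =>
    cases w with
    | nil => simp [truncBracket_nil]
    | cons r w =>
      cases r with
      | zero => simp [leadingZeros] at hw
      | succ r =>
        rw [List.replicate_zero, List.nil_append, truncBracket_cons 0 [],
          truncBracket_cons (r + 1) w, kernelSum_mul_kernelSum, truncBracket_nil, one_mul,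
          ← truncBracket_cons (r + 1) w, ← truncBracket_nil, ← truncBracket_cons 0 [],
          truncBracket_nil, one_mul, List.replicate_succ, List.replicate_zero, List.cons_append,
          List.nil_append, truncBracket_cons 0 (_ :: _), weight_cons]
        have e : ∀ a b c : ℕ → ℚ⟦X⟧, a + b + c - (((0 : ℕ) : ℚ) + 1) • a = b + c := by
          intro a b c
          simp only [Nat.cast_zero, zero_add, one_smul]
          ring
        rw [e]
        refine add_mem ?_ (kernelSum_partSeries_mul_mem_leadSpan (by omega))
        have := truncBracket_mul_mem [0] w
        exact kernelSum_succ_mem_leadSpan this (by simp; omega)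
  | succ m ih =>
    set v := List.replicate (m + 1) 0 ++ w with hv
    have hv' : v = 0 :: (List.replicate m 0 ++ w) := by
      rw [hv, List.replicate_succ, List.cons_append]
    have hv2 : List.replicate (m + 1 + 1) 0 ++ w = 0 :: v := by
      rw [List.replicate_succ, List.cons_append]
    have hwt : weight (List.replicate m 0 ++ w) = weight w + m := by
      simp [weight, add_comm]
    rw [hv2]
    conv in truncBracket [0] * truncBracket v =>
      rw [hv', truncBracket_cons 0 [], truncBracket_cons 0 (_ ++ _), kernelSum_mul_kernelSum,
        truncBracket_nil, one_mul, one_mul, ← truncBracket_cons 0 (_ ++ _), ← hv',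
        ← truncBracket_nil, ← truncBracket_cons 0 [], ← truncBracket_cons 0 v]
    set T := truncBracket [0] * truncBracket (List.replicate m 0 ++ w) with hT
    have e : truncBracket (0 :: v) + kernelSum (partSeries 0) T +
        kernelSum (partSeries 0 * partSeries 0) (truncBracket (List.replicate m 0 ++ w)) -
        (((m + 1 : ℕ) : ℚ) + 1) • truncBracket (0 :: v) =
        kernelSum (partSeries 0) (T - ((m : ℚ) + 1) • truncBracket v) +
        kernelSum (partSeries 0 * partSeries 0) (truncBracket (List.replicate m 0 ++ w)) := by
      rw [map_sub, map_smul, ← truncBracket_cons]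
      push_cast
      module
    -- the letter `0` of `[1]` either comes first, or shuffles into the tail, where the induction
    -- hypothesis applies, or merges with a letter
    rw [e]
    refine add_mem ?_ (kernelSum_partSeries_mul_mem_leadSpan (by omega))
    exact kernelSum_zero_mem_leadSpan ih

/-! ### From truncated brackets to brackets -/

/-- The coefficientwise limit of a sequence of power series whose `n`-th coefficients are
constant from the index `n` on; for other sequences this is a diagonal. -/
noncomputable def limSeries : (ℕ → ℚ⟦X⟧) →ₗ[ℚ] ℚ⟦X⟧ where
  toFun F := mk fun n => coeff n (F n)
  map_add' F G := by ext n; simp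
  map_smul' c F := by ext n; simp

lemma coeff_limSeries (F : ℕ → ℚ⟦X⟧) (n : ℕ) : coeff n (limSeries F) = coeff n (F n) := by
  simp [limSeries]

/-- The `n`-th coefficient is constant from the index `n` on. -/
def IsStable (F : ℕ → ℚ⟦X⟧) : Prop := ∀ n N, n ≤ N → coeff n (F N) = coeff n (F n)

lemma limSeries_mul {F G : ℕ → ℚ⟦X⟧} (hF : IsStable F) (hG : IsStable G) :
    limSeries (F * G) = limSeries F * limSeries G := by
  ext n
  rw [coeff_limSeries, Pi.mul_apply, coeff_mul, coeff_mul]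
  refine Finset.sum_congr rfl fun p hp => ?_
  rw [Finset.HasAntidiagonal.mem_antidiagonal] at hp
  rw [coeff_limSeries, coeff_limSeries, hF p.1 n (by omega), hG p.2 n (by omega)]

lemma coeff_partSeries_mul_eq_zero {r u n : ℕ} (h : n ≤ u) (f : ℚ⟦X⟧) :
    coeff n (partSeries r u * f) = 0 := by
  rw [coeff_mul]
  refine Finset.sum_eq_zero fun p hp => ?_
  rw [Finset.HasAntidiagonal.mem_antidiagonal] at hp
  rw [coeff_partSeries_eq_zero (by omega), zero_mul]

lemma isStable_truncBracket (w : List ℕ) : IsStable (truncBracket w) := by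
  intro n N hN
  cases w with
  | nil => rfl
  | cons r w =>
    rw [truncBracket_cons, kernelSum_apply, kernelSum_apply, map_sum, map_sum]
    symm
    refine Finset.sum_subset (Finset.range_subset_range.mpr hN) fun u _ hu => ?_
    rw [Finset.mem_range, not_lt] at hu
    exact coeff_partSeries_mul_eq_zero hu _

/-- The bracket of a word, without the factorials:
`∑ v_1 ^ r_1 ⋯ v_l ^ r_l X ^ (u_1 v_1 + ⋯ + u_l v_l)` over `u_1 > ⋯ > u_l > 0` and `v_j > 0`. -/
noncomputable def wordBracket (w : List ℕ) : ℚ⟦X⟧ := limSeries (truncBracket w)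

lemma coeff_wordBracket (w : List ℕ) {n N : ℕ} (h : n ≤ N) :
    coeff n (wordBracket w) = coeff n (truncBracket w N) := by
  rw [wordBracket, coeff_limSeries, isStable_truncBracket w n N h]

/-- Truncated brackets over an arbitrary ring, with `X` replaced by `x` and `v_j ≤ M`. -/
def boxBracket {K : Type*} [CommRing K] (x : K) (M : ℕ) : List ℕ → ℕ → K
  | [], _ => 1
  | r :: w, N => ∑ u ∈ Finset.range N,
      (∑ v ∈ Finset.range M, ((v + 1 : ℕ) : K) ^ r * x ^ ((u + 1) * (v + 1))) * boxBracket x M w u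

lemma map_boxBracket {K K' : Type*} [CommRing K] [CommRing K'] (φ : K →+* K') (x : K) (M : ℕ)
    (w : List ℕ) (N : ℕ) : φ (boxBracket x M w N) = boxBracket (φ x) M w N := by
  induction w generalizing N with
  | nil => simp [boxBracket]
  | cons r w ih => simp [boxBracket, ih]

/-- Reduction of power series modulo `X ^ (M + 1)`. -/
noncomputable def truncHom (M : ℕ) : ℚ⟦X⟧ →+* ℚ⟦X⟧ ⧸ Ideal.span {(X : ℚ⟦X⟧) ^ (M + 1)} :=
  Ideal.Quotient.mk _

lemma truncHom_eq_iff {M : ℕ} {f g : ℚ⟦X⟧} :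
    truncHom M f = truncHom M g ↔ ∀ n ≤ M, coeff n f = coeff n g := by
  rw [truncHom, Ideal.Quotient.eq, Ideal.mem_span_singleton, X_pow_dvd_iff]
  simp [sub_eq_zero]

lemma truncHom_X_pow (M : ℕ) : truncHom M X ^ (M + 1) = 0 := by
  rw [← map_pow, ← map_zero (truncHom M), truncHom_eq_iff]
  intro n hn
  rw [coeff_X_pow, if_neg (by omega), map_zero]

lemma truncHom_partSeries (M r u : ℕ) : truncHom M (partSeries r u) =
    ∑ v ∈ Finset.range M, ((v + 1 : ℕ) : _) ^ r * truncHom M X ^ ((u + 1) * (v + 1)) := by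
  have h : truncHom M (partSeries r u) = truncHom M
      (∑ v ∈ Finset.range M, ((v + 1 : ℕ) : ℚ⟦X⟧) ^ r * X ^ ((u + 1) * (v + 1))) := by
    rw [truncHom_eq_iff]
    intro n hn
    rw [coeff_partSeries, map_sum]
    have hc : ∀ v : ℕ, coeff n (((v + 1 : ℕ) : ℚ⟦X⟧) ^ r * X ^ ((u + 1) * (v + 1))) =
        if n = (u + 1) * (v + 1) then ((v + 1 : ℕ) : ℚ) ^ r else 0 := by
      intro v
      have : ((v + 1 : ℕ) : ℚ⟦X⟧) ^ r = C (((v + 1 : ℕ) : ℚ) ^ r) := by simp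
      rw [this, coeff_C_mul, coeff_X_pow, mul_ite, mul_one, mul_zero]
    simp_rw [hc]
    split_ifs with h
    · obtain ⟨⟨m, rfl⟩, h0⟩ := h
      obtain ⟨m, rfl⟩ : ∃ k, m = k + 1 := Nat.exists_eq_succ_of_ne_zero (by
        rintro rfl; simp at h0)
      have hm : m < M := by nlinarith
      rw [Finset.sum_eq_single_of_mem m (Finset.mem_range.mpr hm), if_pos rfl,
        Nat.mul_div_cancel_left _ u.succ_pos]
      intro b _ hb
      rw [if_neg]
      intro hab
      have := Nat.eq_of_mul_eq_mul_left u.succ_pos hab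
      omega
    · symm
      refine Finset.sum_eq_zero fun v _ => if_neg ?_
      rintro rfl
      exact h ⟨Dvd.intro _ rfl, by positivity⟩
  rw [h]
  simp

lemma truncHom_truncBracket (M : ℕ) (w : List ℕ) (N : ℕ) :
    truncHom M (truncBracket w N) = boxBracket (truncHom M X) M w N := by
  induction w generalizing N with
  | nil => simp [boxBracket, truncBracket_nil]
  | cons r w ih =>
    simp [boxBracket, truncBracket_cons, kernelSum_apply, truncHom_partSeries, ih]

/-- The strictly decreasing `u : Fin l → ℕ` with `N ≥ u_1 > ⋯ > u_l > 0`. -/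
def chains (l N : ℕ) : Finset (Fin l → ℕ) :=
  (Fintype.piFinset fun _ : Fin l => Finset.Icc 1 N).filter fun u => ∀ i j, i < j → u j < u i

lemma mem_chains {l N : ℕ} {u : Fin l → ℕ} :
    u ∈ chains l N ↔ (∀ i, 1 ≤ u i ∧ u i ≤ N) ∧ ∀ i j, i < j → u j < u i := by
  simp [chains]

lemma cons_mem_chains {l N u : ℕ} {c : Fin l → ℕ} :
    (Fin.cons (u + 1) c : Fin (l + 1) → ℕ) ∈ chains (l + 1) N ↔ u < N ∧ c ∈ chains l u := by
  simp only [mem_chains, Fin.forall_fin_succ, Fin.cons_zero, Fin.cons_succ, Fin.succ_lt_succ_iff,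
    Fin.succ_pos, Fin.not_lt_zero, IsEmpty.forall_iff, forall_true_left, true_and]
  constructor
  · rintro ⟨⟨h1, h2⟩, h3, h4⟩
    exact ⟨by omega, fun i => ⟨(h2 i).1, by have := h3 i; omega⟩, h4⟩
  · rintro ⟨h1, h2, h3⟩
    refine ⟨⟨by omega, fun i => ⟨(h2 i).1, ?_⟩⟩, fun i => ?_, h3⟩
    · have := (h2 i).2
      omega
    · have := (h2 i).2
      omega

lemma sum_chains_succ {K : Type*} [CommRing K] {l N : ℕ} (f : (Fin (l + 1) → ℕ) → K) :
    ∑ u ∈ chains (l + 1) N, f u =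
      ∑ u ∈ Finset.range N, ∑ c ∈ chains l u, f (Fin.cons (u + 1) c) := by
  rw [Finset.sum_sigma']
  symm
  refine Finset.sum_bij' (fun p _ => Fin.cons (p.1 + 1) p.2)
    (fun u _ => ⟨u 0 - 1, Fin.tail u⟩) ?_ ?_ ?_ ?_ ?_
  · rintro ⟨u, c⟩ h
    rw [Finset.mem_sigma, Finset.mem_range] at h
    exact cons_mem_chains.mpr h
  · intro u hu
    have h0 := ((mem_chains.mp hu).1 0).1
    rw [Finset.mem_sigma, Finset.mem_range]
    rw [← Fin.cons_self_tail u, show u 0 = u 0 - 1 + 1 by omega] at hu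
    exact cons_mem_chains.mp hu
  · rintro ⟨u, c⟩ _
    simp
  · intro u hu
    have h0 := ((mem_chains.mp hu).1 0).1
    simp only [Nat.sub_add_cancel h0, Fin.cons_self_tail]
  · rintro ⟨u, c⟩ _
    rfl

lemma boxBracket_eq_sum_chains {K : Type*} [CommRing K] (x : K) (M : ℕ) (w : List ℕ) (N : ℕ) :
    boxBracket x M w N = ∑ u ∈ chains w.length N, ∏ j, ∑ v ∈ Finset.Icc 1 M,
      (v : K) ^ w.get j * x ^ (u j * v) := by
  induction w generalizing N with
  | nil => simp [boxBracket, chains, Fintype.piFinset_of_isEmpty]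
  | cons r w ih =>
    rw [boxBracket]
    refine Eq.trans ?_ (sum_chains_succ _).symm
    refine Finset.sum_congr rfl fun u _ => ?_
    rw [ih, Finset.mul_sum]
    refine Finset.sum_congr rfl fun c _ => ?_
    refine Eq.trans ?_ (Fin.prod_univ_succ (n := w.length) _).symm
    congr 1
    rw [Finset.range_eq_Ico, Finset.sum_Ico_add' (fun v : ℕ => (v : K) ^ r * x ^ ((u + 1) * v)),
      zero_add]
    rfl

/-- Multiple divisor sums, over all pairs of tuples in a box, are the coefficients of the
recursively defined brackets. -/
lemma coeff_wordBracket_eq (w : List ℕ) (n : ℕ) :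
    coeff n (wordBracket w) = (multipleDivisorSum w.get n : ℚ) := by
  have h := truncHom_truncBracket n w n
  rw [← map_boxBracket, truncHom_eq_iff] at h
  rw [coeff_wordBracket w le_rfl, h n le_rfl, boxBracket_eq_sum_chains]
  simp_rw [Finset.prod_univ_sum]
  rw [map_sum]
  simp_rw [map_sum]
  rw [← Finset.sum_product', multipleDivisorSum, Nat.cast_sum, Finset.sum_filter, chains,
    ← Finset.filter_product_left, Finset.sum_filter]
  refine Finset.sum_congr rfl fun p _ => ?_
  have hc : coeff n (∏ j, ((p.2 j : ℚ⟦X⟧) ^ w.get j * X ^ (p.1 j * p.2 j))) =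
      if ∑ j, p.1 j * p.2 j = n then ((∏ j, p.2 j ^ w.get j : ℕ) : ℚ) else 0 := by
    rw [Finset.prod_mul_distrib, Finset.prod_pow_eq_pow_sum]
    have : ∏ j, (p.2 j : ℚ⟦X⟧) ^ w.get j = C ((∏ j, p.2 j ^ w.get j : ℕ) : ℚ) := by
      simp
    rw [this, coeff_C_mul, coeff_X_pow, mul_ite, mul_one, mul_zero]
    simp only [eq_comm]
  rw [hc, ite_and]

/-! ### The filtered algebra of brackets -/

lemma multipleDivisorSum_eq_coeff {l : ℕ} (r : Fin l → ℕ) (n : ℕ) :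
    (multipleDivisorSum r n : ℚ) = coeff n (wordBracket (List.ofFn r)) := by
  rw [coeff_wordBracket_eq]
  have : ∀ (l' : ℕ) (h : l' = l) (r' : Fin l' → ℕ), (∀ i, r' i = r (Fin.cast h i)) →
      multipleDivisorSum r n = multipleDivisorSum r' n := by
    rintro _ rfl r' hr
    congr 1
    funext i
    exact (hr i).symm
  rw [this _ (List.length_ofFn) (List.ofFn r).get fun i => by simp; rfl]

lemma bracket_eq_smul {l : ℕ} (s : Fin l → ℕ) :
    bracket s = (∏ j, ((s j - 1).factorial : ℚ))⁻¹ •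
      wordBracket (List.ofFn fun j => s j - 1) := by
  ext n
  rw [bracket, coeff_mk, multipleDivisorSum_eq_coeff, map_smul, smul_eq_mul, div_eq_inv_mul]

lemma weight_ofFn {l : ℕ} (s : Fin l → ℕ) (hs : ∀ j, 1 ≤ s j) :
    weight (List.ofFn fun j => s j - 1) = ∑ j, s j := by
  rw [weight, List.map_ofFn, List.sum_ofFn]
  exact Finset.sum_congr rfl fun j _ => Nat.sub_add_cancel (hs j)

lemma wordBracket_eq_smul (w : List ℕ) : ∃ c : ℚ,
    wordBracket w = c • bracket fun j => w.get j + 1 := by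
  refine ⟨∏ j, ((w.get j).factorial : ℚ), ?_⟩
  rw [bracket_eq_smul]
  simp only [Nat.add_sub_cancel]
  rw [smul_inv_smul₀ (Finset.prod_ne_zero_iff.mpr fun j _ => by positivity)]
  congr 1
  exact (List.ofFn_get w).symm

lemma sum_get_add_one (w : List ℕ) : ∑ j, (w.get j + 1) = weight w := by
  have := weight_ofFn (fun j => w.get j + 1) fun j => Nat.le_add_left 1 _
  simpa using this.symm

lemma wordBracket_mem_FilMD {w : List ℕ} {k : ℕ} (h : weight w ≤ k) : wordBracket w ∈ FilMD k := by
  obtain ⟨c, hc⟩ := wordBracket_eq_smul w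
  rw [hc]
  exact Submodule.smul_mem _ _ (Submodule.subset_span
    ⟨_, _, fun j => Nat.le_add_left 1 _, (sum_get_add_one w).trans_le h, rfl⟩)

lemma wordBracket_mem_FilMDA {w : List ℕ} {k : ℕ} (h : weight w ≤ k) (h0 : leadingZeros w = 0) :
    wordBracket w ∈ FilMDA k := by
  obtain ⟨c, hc⟩ := wordBracket_eq_smul w
  rw [hc]
  refine Submodule.smul_mem _ _ (Submodule.subset_span
    ⟨_, _, fun j => Nat.le_add_left 1 _, ?_, (sum_get_add_one w).trans_le h, rfl⟩)
  intro hl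
  match w, h0 with
  | [], _ => simp at hl
  | (r + 1) :: w, _ => simp

lemma FilMD_le {k : ℕ} {S : Submodule ℚ ℚ⟦X⟧}
    (h : ∀ w, weight w ≤ k → wordBracket w ∈ S) : FilMD k ≤ S := by
  refine Submodule.span_le.mpr ?_
  rintro _ ⟨l, s, hs, hk, rfl⟩
  rw [bracket_eq_smul]
  exact S.smul_mem _ (h _ ((weight_ofFn s hs).trans_le hk))

lemma FilMDA_le {k : ℕ} {S : Submodule ℚ ℚ⟦X⟧}
    (h : ∀ w, weight w ≤ k → leadingZeros w = 0 → wordBracket w ∈ S) : FilMDA k ≤ S := by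
  refine Submodule.span_le.mpr ?_
  rintro _ ⟨l, s, hs, ha, hk, rfl⟩
  rw [bracket_eq_smul]
  refine S.smul_mem _ (h _ ((weight_ofFn s hs).trans_le hk) ?_)
  cases l with
  | zero => rfl
  | succ l =>
    rw [List.ofFn_succ]
    have h1 : 1 < s 0 := ha (Nat.succ_pos l)
    obtain ⟨m, hm⟩ : ∃ m, s 0 - 1 = m + 1 := ⟨s 0 - 2, by omega⟩
    rw [hm]
    rfl

lemma FilMD_mono {k m : ℕ} (h : k ≤ m) : FilMD k ≤ FilMD m :=
  FilMD_le fun _ hw => wordBracket_mem_FilMD (hw.trans h)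

lemma FilMDA_mono {k m : ℕ} (h : k ≤ m) : FilMDA k ≤ FilMDA m :=
  FilMDA_le fun _ hw h0 => wordBracket_mem_FilMDA (hw.trans h) h0

lemma FilMDA_le_FilMD (k : ℕ) : FilMDA k ≤ FilMD k :=
  FilMDA_le fun _ hw _ => wordBracket_mem_FilMD hw

lemma limSeries_mem_FilMD {F : ℕ → ℚ⟦X⟧} {k : ℕ} (hF : F ∈ truncSpan k) :
    limSeries F ∈ FilMD k := by
  have : truncSpan k ≤ (FilMD k).comap limSeries := by
    refine Submodule.span_le.mpr ?_
    rintro _ ⟨w, hw, rfl⟩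
    exact wordBracket_mem_FilMD hw
  exact this hF

lemma FilMD_mul_mem {f g : ℚ⟦X⟧} {k m : ℕ} (hf : f ∈ FilMD k) (hg : g ∈ FilMD m) :
    f * g ∈ FilMD (k + m) := by
  have h1 : FilMD k ≤ (FilMD (k + m)).comap (LinearMap.mulRight ℚ g) := by
    refine FilMD_le fun w hw => ?_
    have h2 : FilMD m ≤ (FilMD (k + m)).comap (LinearMap.mulLeft ℚ (wordBracket w)) := by
      refine FilMD_le fun w' hw' => ?_
      change wordBracket w * wordBracket w' ∈ FilMD (k + m)
      rw [wordBracket, wordBracket,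
        ← limSeries_mul (isStable_truncBracket w) (isStable_truncBracket w')]
      exact FilMD_mono (by omega) (limSeries_mem_FilMD (truncBracket_mul_mem w w'))
    exact h2 hg
  exact h1 hf

lemma bracketOne_eq : bracketOne = wordBracket [0] := by
  rw [bracketOne, bracket_eq_smul]
  simp

lemma wordBracket_nil : wordBracket [] = 1 := by
  ext n
  rw [coeff_wordBracket [] le_rfl, truncBracket_nil, Pi.one_apply]

lemma one_mem_FilMD (k : ℕ) : (1 : ℚ⟦X⟧) ∈ FilMD k := by
  rw [← wordBracket_nil]
  exact wordBracket_mem_FilMD (Nat.zero_le k)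

lemma bracketOne_pow_mem_FilMD (k : ℕ) : bracketOne ^ k ∈ FilMD k := by
  induction k with
  | zero => simpa using one_mem_FilMD 0
  | succ k ih =>
    rw [pow_succ]
    exact FilMD_mul_mem ih (by rw [bracketOne_eq]; exact wordBracket_mem_FilMD (by simp))

/-! ### Expansions in powers of `[1]` -/

/-- The space of all sums `∑_{j ≤ k} g_j [1] ^ (k - j)` with `g_j ∈ Fil^W_j(MDA)`. -/
noncomputable def expansionSpan (k : ℕ) : Submodule ℚ ℚ⟦X⟧ where
  carrier := {f | ∃ g, IsExpansion k f g}
  zero_mem' := ⟨0, fun _ _ => Submodule.zero_mem _, by simp⟩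
  add_mem' := by
    rintro f f' ⟨g, hg, rfl⟩ ⟨g', hg', rfl⟩
    refine ⟨g + g', fun j hj => add_mem (hg j hj) (hg' j hj), ?_⟩
    simp [add_mul, Finset.sum_add_distrib]
  smul_mem' := by
    rintro c f ⟨g, hg, rfl⟩
    refine ⟨c • g, fun j hj => Submodule.smul_mem _ _ (hg j hj), ?_⟩
    simp [Finset.smul_sum]

lemma mem_expansionSpan {k : ℕ} {f : ℚ⟦X⟧} : f ∈ expansionSpan k ↔ ∃ g, IsExpansion k f g :=
  Iff.rfl

lemma FilMDA_le_expansionSpan (k : ℕ) : FilMDA k ≤ expansionSpan k := by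
  intro f hf
  refine ⟨fun j => if j = k then f else 0, fun j _ => ?_, ?_⟩
  · dsimp only
    split_ifs with h
    · rwa [h]
    · exact Submodule.zero_mem _
  · rw [Finset.sum_eq_single_of_mem k (by simp)]
    · simp
    · intro j _ hj
      simp [hj]

lemma expansionSpan_succ {k : ℕ} {f : ℚ⟦X⟧} (hf : f ∈ expansionSpan k) :
    f ∈ expansionSpan (k + 1) := by
  obtain ⟨g, hg, rfl⟩ := hf
  refine ⟨fun j => if j = 0 then 0 else g (j - 1), fun j hj => ?_, ?_⟩
  · dsimp only
    split_ifs with h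
    · exact Submodule.zero_mem _
    · exact FilMDA_mono (Nat.sub_le j 1) (hg _ (by omega))
  · rw [Finset.sum_range_succ' _ (k + 1)]
    simp

lemma expansionSpan_mono {k m : ℕ} (h : k ≤ m) : expansionSpan k ≤ expansionSpan m := by
  induction m, h using Nat.le_induction with
  | base => exact le_rfl
  | succ m _ ih => exact fun f hf => expansionSpan_succ (ih hf)

lemma bracketOne_mul_mem_expansionSpan {k : ℕ} {f : ℚ⟦X⟧} (hf : f ∈ expansionSpan k) :
    bracketOne * f ∈ expansionSpan (k + 1) := by
  obtain ⟨g, hg, rfl⟩ := hf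
  refine ⟨fun j => if j ≤ k then g j else 0, fun j _ => ?_, ?_⟩
  · dsimp only
    split_ifs with h
    · exact hg j h
    · exact Submodule.zero_mem _
  · rw [Finset.sum_range_succ _ (k + 1), Finset.mul_sum]
    simp only [Nat.not_succ_le_self, if_false, zero_mul, add_zero]
    refine Finset.sum_congr rfl fun j hj => ?_
    rw [Finset.mem_range] at hj
    rw [if_pos (by omega), show k + 1 - j = k - j + 1 by omega, pow_succ]
    ring

/-- Induction on the weight `k` and on the number `m` of leading ones: a word with `m + 1` leading
ones is `[1] / (m + 1)` times the word with `m` of them, up to simpler words. -/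
lemma wordBracket_mem_expansionSpan (k m : ℕ) (w : List ℕ) (hk : weight w ≤ k)
    (hm : leadingZeros w ≤ m) : wordBracket w ∈ expansionSpan k := by
  induction k using Nat.strong_induction_on generalizing m w with
  | _ k ihk =>
  induction m generalizing w with
  | zero => exact FilMDA_le_expansionSpan k (wordBracket_mem_FilMDA hk (by omega))
  | succ m ihm =>
    rcases hm.lt_or_eq with h | h
    · exact ihm w hk (by omega)
    obtain ⟨w', h0, hw⟩ := exists_eq_replicate_append w
    rw [h] at hw
    have hwt : weight w = weight w' + m + 1 := by
      rw [hw]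
      simp [weight]
      ring
    have hwt' : weight (List.replicate m 0 ++ w') = weight w' + m := by
      simp [weight, add_comm]
    have key := truncBracket_zero_mul m w' h0
    rw [← hw] at key
    have hlead : leadSpan (weight w' + m + 1) m ≤ (expansionSpan k).comap limSeries := by
      refine Submodule.span_le.mpr ?_
      rintro _ ⟨z, hz, hz', rfl⟩
      change wordBracket z ∈ expansionSpan k
      rcases hz' with hz' | hz'
      · exact ihm z (by omega) hz'
      · exact expansionSpan_mono (by omega : weight z ≤ k)
          (ihk (weight z) (by omega) (leadingZeros z) z le_rfl le_rfl)
    have h1 := hlead key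
    rw [Submodule.mem_comap, map_sub, map_smul,
      limSeries_mul (isStable_truncBracket _) (isStable_truncBracket _)] at h1
    change wordBracket [0] * wordBracket _ - _ • wordBracket w ∈ _ at h1
    rw [← bracketOne_eq] at h1
    have h2 : bracketOne * wordBracket (List.replicate m 0 ++ w') ∈ expansionSpan k :=
      expansionSpan_mono (by omega : weight w' + m + 1 ≤ k) (bracketOne_mul_mem_expansionSpan
        (ihk (weight w' + m) (by omega) _ _ hwt'.le le_rfl))
    have h3 := Submodule.smul_mem _ ((m : ℚ) + 1)⁻¹ (sub_mem h2 h1)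
    rwa [sub_sub_cancel, inv_smul_smul₀ (by positivity)] at h3

/-- `Fil^W_k(MD)` consists of the polynomials in `[1]` over the admissible brackets, of total
weight at most `k`. -/
lemma mem_FilMD_iff {k : ℕ} {f : ℚ⟦X⟧} : f ∈ FilMD k ↔ ∃ g, IsExpansion k f g := by
  rw [← mem_expansionSpan]
  constructor
  · exact fun h => FilMD_le (fun w hw => wordBracket_mem_expansionSpan k _ w hw le_rfl) h
  · rintro ⟨g, hg, rfl⟩
    refine Submodule.sum_mem _ fun j hj => ?_
    rw [Finset.mem_range] at hj
    have := FilMD_mul_mem (FilMDA_le_FilMD j (hg j (by omega))) (bracketOne_pow_mem_FilMD (k - j))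
    rwa [Nat.add_sub_cancel' (by omega)] at this

/-! ### Brackets in conjugate coordinates -/

/-- The operator that adds a new smallest partial sum `n + 1 > N` to a chain, with the
weight `(n + 1 - N) ^ r`:
`(M, N) ↦ ∑_{N ≤ n < M} (n + 1 - N) ^ r * X ^ (n + 1) / (1 - X ^ (n + 1)) * F M (n + 1)`. -/
noncomputable def tailSum (r : ℕ) : (ℕ → ℕ → ℚ⟦X⟧) →ₗ[ℚ] (ℕ → ℕ → ℚ⟦X⟧) where
  toFun F M N := ∑ n ∈ Finset.Ico N M,
    ((n + 1 - N : ℕ) : ℚ⟦X⟧) ^ r * (partSeries 0 n * F M (n + 1))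
  map_add' F G := by
    funext M N
    simp [mul_add, Finset.sum_add_distrib]
  map_smul' c F := by
    funext M N
    simp [Finset.smul_sum]

lemma tailSum_apply (r : ℕ) (F : ℕ → ℕ → ℚ⟦X⟧) (M N : ℕ) : tailSum r F M N =
    ∑ n ∈ Finset.Ico N M, ((n + 1 - N : ℕ) : ℚ⟦X⟧) ^ r * (partSeries 0 n * F M (n + 1)) := rfl

/-- Multiplication by the `a`-th power of the lower bound. -/
noncomputable def mulVar (a : ℕ) : (ℕ → ℕ → ℚ⟦X⟧) →ₗ[ℚ] (ℕ → ℕ → ℚ⟦X⟧) where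
  toFun F M N := (N : ℚ⟦X⟧) ^ a * F M N
  map_add' F G := by
    funext M N
    simp [mul_add]
  map_smul' c F := by
    funext M N
    simp

lemma mulVar_apply (a : ℕ) (F : ℕ → ℕ → ℚ⟦X⟧) (M N : ℕ) :
    mulVar a F M N = (N : ℚ⟦X⟧) ^ a * F M N := rfl

/-- The bracket in conjugate coordinates: the sum over `N < n_1 < ⋯ < n_l ≤ M` of
`∏ (n_j - n_{j-1}) ^ r_j X ^ n_j / (1 - X ^ n_j)`, where `n_0 = N`. For `N = 0` one
has `n_j = v_1 + ⋯ + v_j` in terms of the multiplicities of a partition. -/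
noncomputable def dualBracket : List ℕ → ℕ → ℕ → ℚ⟦X⟧
  | [] => 1
  | r :: w => tailSum r (dualBracket w)

section Duality

variable {K : Type*} [CommRing K] (x : K) (M : ℕ)

/-- The truncated geometric series `∑_{1 ≤ j ≤ M} x ^ ((n + 1) j)`. -/
def truncGeom (n : ℕ) : K := ∑ j ∈ Finset.range M, x ^ ((n + 1) * (j + 1))

/-- The box sum of a word in which the exponent of the largest part is raised by `N`. -/
def shiftedBox (N : ℕ) : List ℕ → K
  | [] => 1
  | r :: w => ∑ u ∈ Finset.range M, x ^ (N * (u + 1)) *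
      ((∑ v ∈ Finset.range M, ((v + 1 : ℕ) : K) ^ r * x ^ ((u + 1) * (v + 1))) *
        boxBracket x M w u)

variable {x M}

lemma truncGeom_eq_zero (hx : x ^ (M + 1) = 0) {n : ℕ} (hn : M ≤ n) : truncGeom x M n = 0 := by
  refine Finset.sum_eq_zero fun j _ => ?_
  exact pow_eq_zero_of_le (by nlinarith) hx

lemma sum_Ico_pow_eq (hx : x ^ (M + 1) = 0) (n t : ℕ) :
    ∑ u ∈ Finset.Ico (t + 1) M, x ^ ((n + 1) * (u + 1)) =
      truncGeom x M n * x ^ ((n + 1) * (t + 1)) := by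
  rw [Finset.sum_Ico_eq_sum_range, truncGeom, Finset.sum_mul]
  have h : ∀ j, x ^ ((n + 1) * (j + 1)) * x ^ ((n + 1) * (t + 1)) =
      x ^ ((n + 1) * (t + 1 + j + 1)) := fun j => by rw [← pow_add]; congr 1; ring
  simp_rw [h]
  refine Finset.sum_subset (Finset.range_subset_range.mpr (Nat.sub_le _ _)) fun j _ hj => ?_
  rw [Finset.mem_range, not_lt] at hj
  refine pow_eq_zero_of_le ?_ hx
  have : M + 1 ≤ t + 1 + j + 1 := by omega
  nlinarith

lemma sum_pow_mul_boxBracket (hx : x ^ (M + 1) = 0) (n : ℕ) (w : List ℕ) :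
    ∑ u ∈ Finset.range M, x ^ ((n + 1) * (u + 1)) * boxBracket x M w u =
      truncGeom x M n * shiftedBox x M (n + 1) w := by
  cases w with
  | nil => simp [boxBracket, shiftedBox, truncGeom]
  | cons r w =>
    simp_rw [boxBracket, shiftedBox, Finset.mul_sum]
    rw [Finset.sum_comm' (t' := Finset.range M) (s' := fun t => Finset.Ico (t + 1) M)]
    · refine Finset.sum_congr rfl fun t _ => ?_
      rw [← Finset.sum_mul, sum_Ico_pow_eq hx, mul_assoc]
    · intro u t
      simp only [Finset.mem_range, Finset.mem_Ico]
      omega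

/-- Summing the largest part over a geometric series turns the exponent of the largest part
into the first partial sum of the conjugate coordinates. -/
lemma shiftedBox_cons (hx : x ^ (M + 1) = 0) (N r : ℕ) (w : List ℕ) :
    shiftedBox x M N (r :: w) = ∑ n ∈ Finset.Ico N M,
      ((n + 1 - N : ℕ) : K) ^ r * (truncGeom x M n * shiftedBox x M (n + 1) w) := by
  have h1 : shiftedBox x M N (r :: w) = ∑ v ∈ Finset.range M,
      ((v + 1 : ℕ) : K) ^ r * (truncGeom x M (N + v) * shiftedBox x M (N + v + 1) w) := by
    simp_rw [← sum_pow_mul_boxBracket hx, shiftedBox, Finset.mul_sum, Finset.sum_mul,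
      Finset.mul_sum]
    rw [Finset.sum_comm]
    refine Finset.sum_congr rfl fun v _ => Finset.sum_congr rfl fun u _ => ?_
    have : x ^ ((N + v + 1) * (u + 1)) = x ^ (N * (u + 1)) * x ^ ((u + 1) * (v + 1)) := by
      rw [← pow_add]
      congr 1
      ring
    rw [this]
    ring
  rw [h1, Finset.sum_Ico_eq_sum_range]
  symm
  have h2 : ∀ v, N + v + 1 - N = v + 1 := fun v => by omega
  simp_rw [h2]
  refine Finset.sum_subset (Finset.range_subset_range.mpr (Nat.sub_le _ _)) fun j _ hj => ?_
  rw [Finset.mem_range, not_lt] at hj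
  rw [truncGeom_eq_zero hx (by omega), zero_mul, mul_zero]

end Duality

lemma truncHom_dualBracket (M N : ℕ) (w : List ℕ) :
    truncHom M (dualBracket w M N) = shiftedBox (truncHom M X) M N w := by
  induction w generalizing N with
  | nil => simp [dualBracket, shiftedBox]
  | cons r w ih =>
    rw [shiftedBox_cons (truncHom_X_pow M), dualBracket, tailSum_apply, map_sum]
    refine Finset.sum_congr rfl fun n _ => ?_
    rw [map_mul, map_mul, ih, truncHom_partSeries, map_pow, map_natCast, truncGeom]
    simp

/-- Both coordinate systems on partitions give the same bracket. -/
lemma coeff_dualBracket {n M : ℕ} (h : n ≤ M) (w : List ℕ) :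
    coeff n (dualBracket w M 0) = coeff n (wordBracket w) := by
  rw [coeff_wordBracket w h]
  refine truncHom_eq_iff.mp ?_ n h
  rw [truncHom_dualBracket, truncHom_truncBracket]
  cases w <;> simp [shiftedBox, boxBracket]

lemma isStable_dualBracket (w : List ℕ) : IsStable fun M => dualBracket w M 0 := by
  intro n N h
  rw [coeff_dualBracket h, coeff_dualBracket le_rfl]

lemma limSeries_dualBracket (w : List ℕ) :
    limSeries (fun M => dualBracket w M 0) = wordBracket w := by
  ext n
  rw [coeff_limSeries, coeff_dualBracket le_rfl]

/-- The span of the functions `N ^ a * dualBracket w` of weight `a + weight w ≤ k`. -/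
noncomputable def dualSpan (k : ℕ) : Submodule ℚ (ℕ → ℕ → ℚ⟦X⟧) :=
  Submodule.span ℚ {F | ∃ a w, a + weight w ≤ k ∧ F = mulVar a (dualBracket w)}

lemma mulVar_dualBracket_mem {a k : ℕ} {w : List ℕ} (h : a + weight w ≤ k) :
    mulVar a (dualBracket w) ∈ dualSpan k :=
  Submodule.subset_span ⟨a, w, h, rfl⟩

lemma mulVar_mem_dualSpan {F : ℕ → ℕ → ℚ⟦X⟧} {k m b : ℕ} (hF : F ∈ dualSpan k)
    (h : k + b ≤ m) : mulVar b F ∈ dualSpan m := by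
  have : dualSpan k ≤ (dualSpan m).comap (mulVar b) := by
    refine Submodule.span_le.mpr ?_
    rintro _ ⟨a, w, hw, rfl⟩
    have e : mulVar b (mulVar a (dualBracket w)) = mulVar (b + a) (dualBracket w) := by
      funext M N
      simp only [mulVar_apply]
      ring
    change mulVar b (mulVar a (dualBracket w)) ∈ dualSpan m
    rw [e]
    exact mulVar_dualBracket_mem (by omega)
  exact this hF

lemma tailSum_mulVar (r a : ℕ) (F : ℕ → ℕ → ℚ⟦X⟧) : tailSum r (mulVar a F) =
    ∑ i ∈ Finset.range (a + 1), a.choose i • mulVar (a - i) (tailSum (r + i) F) := by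
  funext M N
  simp only [Finset.sum_apply, Pi.smul_apply, mulVar_apply, tailSum_apply, Finset.mul_sum,
    Finset.smul_sum]
  rw [Finset.sum_comm]
  refine Finset.sum_congr rfl fun n hn => ?_
  have hn' := (Finset.mem_Ico.mp hn).1
  have h : ((n + 1 : ℕ) : ℚ⟦X⟧) ^ a = (((n + 1 - N : ℕ) : ℚ⟦X⟧) + (N : ℚ⟦X⟧)) ^ a := by
    rw [← Nat.cast_add, Nat.sub_add_cancel (by omega)]
  rw [h, add_pow, Finset.sum_mul, Finset.mul_sum, Finset.mul_sum]
  refine Finset.sum_congr rfl fun i _ => ?_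
  rw [nsmul_eq_mul]
  ring

lemma tailSum_mem_dualSpan {F : ℕ → ℕ → ℚ⟦X⟧} {k m r : ℕ} (hF : F ∈ dualSpan k)
    (h : k + r + 1 ≤ m) : tailSum r F ∈ dualSpan m := by
  have : dualSpan k ≤ (dualSpan m).comap (tailSum r) := by
    refine Submodule.span_le.mpr ?_
    rintro _ ⟨a, w, hw, rfl⟩
    change tailSum r (mulVar a (dualBracket w)) ∈ dualSpan m
    rw [tailSum_mulVar]
    refine Submodule.sum_mem _ fun i hi => nsmul_mem ?_ _
    rw [Finset.mem_range] at hi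
    exact mulVar_dualBracket_mem (w := (r + i) :: w) (by rw [weight_cons]; omega)
  exact this hF

lemma limSeries_mem_of_dualSpan {F : ℕ → ℕ → ℚ⟦X⟧} {k : ℕ} (hF : F ∈ dualSpan k) :
    limSeries (fun M => F M 0) ∈ FilMD k := by
  let ev : (ℕ → ℕ → ℚ⟦X⟧) →ₗ[ℚ] (ℕ → ℚ⟦X⟧) := ⟨⟨fun F M => F M 0, fun _ _ => rfl⟩, fun _ _ => rfl⟩
  have : dualSpan k ≤ (FilMD k).comap (limSeries ∘ₗ ev) := by
    refine Submodule.span_le.mpr ?_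
    rintro _ ⟨a, w, hw, rfl⟩
    change limSeries (fun M => mulVar a (dualBracket w) M 0) ∈ FilMD k
    cases a with
    | zero =>
      have : (fun M => mulVar 0 (dualBracket w) M 0) = fun M => dualBracket w M 0 := by
        funext M
        simp [mulVar_apply]
      rw [this, limSeries_dualBracket]
      exact wordBracket_mem_FilMD (by omega)
    | succ a =>
      have : (fun M => mulVar (a + 1) (dualBracket w) M 0) = 0 := by
        funext M
        simp [mulVar_apply]
      rw [this, map_zero]
      exact Submodule.zero_mem _
  exact this hF

/-! ### The derivation on brackets -/

lemma qDeriv_expand (p : ℕ) (hp : p ≠ 0) (f : ℚ⟦X⟧) :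
    qDeriv (expand p hp f) = (p : ℚ⟦X⟧) * expand p hp (qDeriv f) := by
  ext n
  have hc : (p : ℚ⟦X⟧) = C (p : ℚ) := by simp
  rw [coeff_qDeriv, hc, coeff_C_mul, coeff_expand, coeff_expand, coeff_qDeriv]
  split_ifs with h
  · obtain ⟨m, rfl⟩ := h
    rw [Nat.mul_div_cancel_left _ (Nat.pos_of_ne_zero hp)]
    push_cast
    ring
  · simp

lemma qDeriv_partSeries_zero (n : ℕ) : qDeriv (partSeries 0 n) =
    ((n + 1 : ℕ) : ℚ⟦X⟧) * (partSeries 0 n + partSeries 0 n ^ 2) := by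
  rw [partSeries, qDeriv_expand, qDeriv_powSeries_zero, map_add, map_pow]

lemma qDeriv_natCast_mul (n : ℕ) (f : ℚ⟦X⟧) : qDeriv ((n : ℚ⟦X⟧) * f) = n * qDeriv f := by
  rw [← nsmul_eq_mul, ← nsmul_eq_mul]
  exact map_nsmul qDerivLin n f

/-- Splitting a product of two sums over `[N, M)` according to the order of the indices. -/
lemma sum_Ico_mul_sum_Ico {K : Type*} [CommRing K] (a b : ℕ → K) (N M : ℕ) :
    (∑ m ∈ Finset.Ico N M, a m) * ∑ n ∈ Finset.Ico N M, b n =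
      ∑ n ∈ Finset.Ico N M, b n * ∑ m ∈ Finset.Ico (n + 1) M, a m +
      ∑ n ∈ Finset.Ico N M, a n * b n +
      ∑ m ∈ Finset.Ico N M, a m * ∑ n ∈ Finset.Ico (m + 1) M, b n := by
  rcases le_total M N with h | h
  · simp [Finset.Ico_eq_empty_of_le h]
  · induction h using Nat.decreasingInduction with
    | self => simp
    | of_succ N hN ih =>
      simp only [Finset.sum_eq_sum_Ico_succ_bot hN]
      linear_combination ih

/-- The truncation `∑_{N ≤ m < M} (m + 1) X ^ (m + 1) / (1 - X ^ (m + 1))` of the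
bracket `[2]` in conjugate coordinates. -/
noncomputable def dualTwo : ℕ → ℕ → ℚ⟦X⟧ := tailSum 0 (mulVar 1 1)

lemma dualTwo_apply (M N : ℕ) : dualTwo M N =
    ∑ m ∈ Finset.Ico N M, ((m + 1 : ℕ) : ℚ⟦X⟧) * partSeries 0 m := by
  rw [dualTwo, tailSum_apply]
  refine Finset.sum_congr rfl fun m _ => ?_
  simp only [mulVar_apply, Pi.one_apply]
  ring

lemma dualTwo_apply_zero (M : ℕ) : dualTwo M 0 = dualBracket [1] M 0 := by
  rw [dualTwo_apply, dualBracket, tailSum_apply]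
  simp [dualBracket]

/-- Multiplication by `[2]` minus the derivation. -/
noncomputable def twoSubDeriv (F : ℕ → ℕ → ℚ⟦X⟧) : ℕ → ℕ → ℚ⟦X⟧ :=
  fun M N => dualTwo M N * F M N - qDeriv (F M N)

/-- In conjugate coordinates `[2]` is a sum over one additional index `m`. If `m` is one of the
indices `n` of the chain, then `n e_n ^ 2 = q d/dq e_n - n e_n` for `e_n = X ^ n / (1 - X ^ n)`;
otherwise `m` is inserted in the chain and the weights are expanded by the binomial theorem. -/
lemma twoSubDeriv_tailSum (r : ℕ) (F : ℕ → ℕ → ℚ⟦X⟧) : twoSubDeriv (tailSum r F) =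
    tailSum r (twoSubDeriv F) - tailSum r (mulVar 1 F) + ∑ i ∈ Finset.range (r + 1),
      r.choose i • tailSum i (mulVar 1 (tailSum (r - i) F)) := by
  funext M N
  have h1 := sum_Ico_mul_sum_Ico (fun m => ((m + 1 : ℕ) : ℚ⟦X⟧) * partSeries 0 m)
    (fun n => ((n + 1 - N : ℕ) : ℚ⟦X⟧) ^ r * (partSeries 0 n * F M (n + 1))) N M
  simp_rw [← dualTwo_apply] at h1
  have h2 : qDeriv (tailSum r F M N) = ∑ n ∈ Finset.Ico N M, ((n + 1 - N : ℕ) : ℚ⟦X⟧) ^ r *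
      (((n + 1 : ℕ) : ℚ⟦X⟧) * (partSeries 0 n + partSeries 0 n ^ 2) * F M (n + 1) +
        partSeries 0 n * qDeriv (F M (n + 1))) := by
    rw [tailSum_apply, qDeriv_sum]
    refine Finset.sum_congr rfl fun n _ => ?_
    rw [← Nat.cast_pow, qDeriv_natCast_mul, qDeriv_mul, qDeriv_partSeries_zero]
  have h3 : (∑ m ∈ Finset.Ico N M, ((m + 1 : ℕ) : ℚ⟦X⟧) * partSeries 0 m *
      ∑ n ∈ Finset.Ico (m + 1) M,
        ((n + 1 - N : ℕ) : ℚ⟦X⟧) ^ r * (partSeries 0 n * F M (n + 1))) =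
      (∑ i ∈ Finset.range (r + 1),
        r.choose i • tailSum i (mulVar 1 (tailSum (r - i) F))) M N := by
    simp only [Finset.sum_apply, Pi.smul_apply, mulVar_apply, tailSum_apply, Finset.mul_sum,
      Finset.smul_sum]
    conv_rhs => rw [Finset.sum_comm]
    refine Finset.sum_congr rfl fun m hm => ?_
    conv_rhs => rw [Finset.sum_comm]
    refine Finset.sum_congr rfl fun n hn => ?_
    have hm' := (Finset.mem_Ico.mp hm).1
    have hn' := (Finset.mem_Ico.mp hn).1
    have h : ((n + 1 - N : ℕ) : ℚ⟦X⟧) ^ r =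
        (((m + 1 - N : ℕ) : ℚ⟦X⟧) + ((n + 1 - (m + 1) : ℕ) : ℚ⟦X⟧)) ^ r := by
      rw [← Nat.cast_add]
      congr 2
      omega
    rw [h, add_pow, Finset.sum_mul, Finset.mul_sum]
    refine Finset.sum_congr rfl fun i _ => ?_
    rw [nsmul_eq_mul]
    ring
  rw [h3] at h1
  simp only [twoSubDeriv, Pi.add_apply, Pi.sub_apply]
  rw [h2]
  rw [tailSum_apply, h1, add_sub_right_comm]
  congr 1
  rw [tailSum_apply, tailSum_apply, ← Finset.sum_add_distrib, ← Finset.sum_sub_distrib,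
    ← Finset.sum_sub_distrib]
  refine Finset.sum_congr rfl fun n _ => ?_
  simp only [mulVar_apply, twoSubDeriv]
  ring

lemma twoSubDeriv_dualBracket_mem (w : List ℕ) :
    twoSubDeriv (dualBracket w) ∈ dualSpan (weight w + 2) := by
  have hmem : ∀ w, dualBracket w ∈ dualSpan (weight w) := by
    intro w
    have : dualBracket w = mulVar 0 (dualBracket w) := by
      funext M N
      simp [mulVar_apply]
    rw [this]
    exact mulVar_dualBracket_mem (by omega)
  induction w with
  | nil =>
    have : twoSubDeriv (dualBracket []) = tailSum 0 (mulVar 1 (dualBracket [])) := by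
      funext M N
      simp [twoSubDeriv, dualBracket, dualTwo, qDeriv]
    rw [this]
    exact tailSum_mem_dualSpan (mulVar_mem_dualSpan (hmem []) le_rfl) (by simp)
  | cons r w ih =>
    rw [dualBracket, twoSubDeriv_tailSum, weight_cons]
    refine add_mem (sub_mem ?_ ?_) (Submodule.sum_mem _ fun i hi => nsmul_mem ?_ _)
    · exact tailSum_mem_dualSpan ih (by omega)
    · exact tailSum_mem_dualSpan (mulVar_mem_dualSpan (hmem w) le_rfl) (by omega)
    · rw [Finset.mem_range] at hi
      exact tailSum_mem_dualSpan (mulVar_mem_dualSpan (tailSum_mem_dualSpan (hmem w) le_rfl)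
        le_rfl) (by omega)

/-- Taking the limit `M → ∞` at `N = 0` in conjugate coordinates shows that `[2] * w - q d/dq w`
has weight at most `weight w + 2`, and so has `[2] * w`. -/
lemma qDeriv_wordBracket_mem (w : List ℕ) : qDeriv (wordBracket w) ∈ FilMD (weight w + 2) := by
  have h := limSeries_mem_of_dualSpan (twoSubDeriv_dualBracket_mem w)
  have e : limSeries (fun M => twoSubDeriv (dualBracket w) M 0) =
      wordBracket [1] * wordBracket w - qDeriv (wordBracket w) := by
    have e1 : (fun M => twoSubDeriv (dualBracket w) M 0) =
        ((fun M => dualBracket [1] M 0) * fun M => dualBracket w M 0) -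
          fun M => qDeriv (dualBracket w M 0) := by
      funext M
      simp only [twoSubDeriv, dualTwo_apply_zero, Pi.sub_apply, Pi.mul_apply]
    rw [e1, map_sub, limSeries_mul (isStable_dualBracket _) (isStable_dualBracket _),
      limSeries_dualBracket, limSeries_dualBracket]
    congr 1
    ext n
    rw [coeff_limSeries, coeff_qDeriv, coeff_qDeriv, coeff_dualBracket le_rfl]
  rw [e] at h
  have h2 : wordBracket [1] * wordBracket w ∈ FilMD (weight w + 2) := by
    rw [add_comm]
    exact FilMD_mul_mem (wordBracket_mem_FilMD (by simp)) (wordBracket_mem_FilMD le_rfl)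
  have := sub_mem h2 h
  rwa [sub_sub_cancel] at this

/-- The derivation `q d/dq` raises the weight by at most `2`. -/
lemma qDeriv_mem_FilMD {k : ℕ} {f : ℚ⟦X⟧} (hf : f ∈ FilMD k) : qDeriv f ∈ FilMD (k + 2) := by
  have : FilMD k ≤ (FilMD (k + 2)).comap qDerivLin :=
    FilMD_le fun w hw => FilMD_mono (by omega) (qDeriv_wordBracket_mem w)
  exact this hf

/-! ### Modular forms for `SL₂(ℤ)` are combinations of brackets -/

/-- The complex span of `Fil^W_k(MD)` in `ℂ⟦X⟧`. -/
noncomputable def FilMDComplex (k : ℕ) : Submodule ℂ ℂ⟦X⟧ :=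
  Submodule.span ℂ (PowerSeries.map (algebraMap ℚ ℂ) '' FilMD k)

lemma map_mem_FilMDComplex {k : ℕ} {f : ℚ⟦X⟧} (hf : f ∈ FilMD k) :
    PowerSeries.map (algebraMap ℚ ℂ) f ∈ FilMDComplex k :=
  Submodule.subset_span ⟨f, hf, rfl⟩

lemma FilMDComplex_mul_mem {f g : ℂ⟦X⟧} {k m : ℕ} (hf : f ∈ FilMDComplex k)
    (hg : g ∈ FilMDComplex m) : f * g ∈ FilMDComplex (k + m) := by
  have h : f * g ∈ FilMDComplex k * FilMDComplex m := Submodule.mul_mem_mul hf hg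
  rw [FilMDComplex, FilMDComplex, Submodule.span_mul_span] at h
  refine (Submodule.span_le.mpr ?_ : Submodule.span ℂ _ ≤ FilMDComplex (k + m)) h
  rintro _ ⟨_, ⟨a, ha, rfl⟩, _, ⟨b, hb, rfl⟩, rfl⟩
  change PowerSeries.map _ a * PowerSeries.map _ b ∈ FilMDComplex (k + m)
  rw [← map_mul]
  exact map_mem_FilMDComplex (FilMD_mul_mem ha hb)

/-- A rational power series in the complex span of `Fil^W_k(MD)` lies in `Fil^W_k(MD)`. -/
lemma mem_FilMD_of_map_mem {k : ℕ} {f : ℚ⟦X⟧}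
    (hf : PowerSeries.map (algebraMap ℚ ℂ) f ∈ FilMDComplex k) : f ∈ FilMD k := by
  -- a `ℚ`-linear retraction of `ℚ → ℂ`, applied to the coefficients
  obtain ⟨π, hπ⟩ := (Algebra.linearMap ℚ ℂ).exists_leftInverse_of_injective
    (LinearMap.ker_eq_bot.mpr (algebraMap ℚ ℂ).injective)
  have hπ' : ∀ q : ℚ, π (algebraMap ℚ ℂ q) = q := fun q => LinearMap.congr_fun hπ q
  have key : ∀ F ∈ FilMDComplex k, ∀ c : ℂ,
      (mk fun n => π (c * coeff n F) : ℚ⟦X⟧) ∈ FilMD k := by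
    intro F hF
    induction hF using Submodule.span_induction with
    | mem F hF =>
      obtain ⟨g, hg, rfl⟩ := hF
      intro c
      have : (mk fun n => π (c * coeff n (PowerSeries.map (algebraMap ℚ ℂ) g)) : ℚ⟦X⟧) =
          π c • g := by
        ext n
        rw [coeff_mk, coeff_map, map_smul, mul_comm, ← Algebra.smul_def, map_smul, smul_eq_mul,
          smul_eq_mul, mul_comm]
      rw [this]
      exact Submodule.smul_mem _ _ hg
    | zero =>
      intro c
      convert! Submodule.zero_mem (FilMD k)
      ext n
      simp
    | add F G _ _ hF hG =>
      intro c
      convert! add_mem (hF c) (hG c)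
      ext n
      simp [mul_add]
    | smul a F _ hF =>
      intro c
      convert! hF (c * a) using 1
      ext n
      simp [mul_assoc]
  convert! key _ hf 1
  ext n
  rw [coeff_mk, one_mul, coeff_map, hπ']

section ModularForms

open UpperHalfPlane ModularForm EisensteinSeries

lemma coeff_wordBracket_singleton (r n : ℕ) :
    coeff n (wordBracket [r]) = (ArithmeticFunction.sigma r n : ℚ) := by
  rw [coeff_wordBracket [r] le_rfl, truncBracket_cons, kernelSum_apply, map_sum, truncBracket_nil]
  simp only [Pi.one_apply, mul_one, coeff_partSeries]
  rcases Nat.eq_zero_or_pos n with rfl | hn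
  · simp
  rw [ArithmeticFunction.sigma_apply, ← Nat.sum_div_divisors, Nat.cast_sum, ← Finset.sum_filter]
  refine Finset.sum_bij (fun u _ => u + 1) ?_ ?_ ?_ ?_
  · intro u hu
    simp only [Finset.mem_filter] at hu
    exact Nat.mem_divisors.mpr hu.2
  · intro a _ b _ h
    omega
  · intro d hd
    have hd' := Nat.mem_divisors.mp hd
    have h1 := Nat.pos_of_mem_divisors hd
    have h2 := Nat.le_of_dvd hn hd'.1
    refine ⟨d - 1, ?_, by omega⟩
    rw [Finset.mem_filter, Finset.mem_range, Nat.sub_add_cancel h1]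
    exact ⟨by omega, hd'⟩
  · intro u _
    push_cast
    rfl

lemma one_mem_FilMDComplex (k : ℕ) : (1 : ℂ⟦X⟧) ∈ FilMDComplex k := by
  rw [← map_one (PowerSeries.map (algebraMap ℚ ℂ))]
  exact map_mem_FilMDComplex (one_mem_FilMD k)

lemma qExpansion_E_mem {k : ℕ} (hk : 3 ≤ k) (hk2 : Even k) :
    qExpansion 1 (E hk) ∈ FilMDComplex k := by
  have h : qExpansion 1 (E hk) = 1 + (-(2 * k / bernoulli k : ℂ)) •
      PowerSeries.map (algebraMap ℚ ℂ) (wordBracket [k - 1]) := by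
    ext n
    rw [E_qExpansion_coeff hk hk2, map_add, map_smul, coeff_map, coeff_wordBracket_singleton,
      coeff_one]
    split_ifs with h
    · simp [h]
    · simp
  rw [h]
  exact add_mem (one_mem_FilMDComplex k) (Submodule.smul_mem _ _
    (map_mem_FilMDComplex (wordBracket_mem_FilMD (by simp; omega))))

/-- `1728 Δ = E₄ ^ 3 - E₆ ^ 2`. -/
lemma qExpansion_discriminant_mem :
    qExpansion 1 (CuspForm.discriminant : ℍ → ℂ) ∈ FilMDComplex 12 := by
  have h1 : (CuspForm.discriminant : ℍ → ℂ) = ((1 / 1728 : ℂ) •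
      ((E₄.pow 3).mcast (by norm_num) - (E₆.pow 2).mcast (by norm_num) : ModularForm 𝒮ℒ 12) :
        ModularForm 𝒮ℒ 12) := by
    funext z
    rw [CuspForm.coe_discriminant, discriminant_eq_E₄_cube_sub_E₆_sq]
    simp only [FunLike.coe_smul, FunLike.coe_sub, coe_mcast, ModularForm.coe_pow, Pi.smul_apply,
      Pi.sub_apply, Pi.pow_apply, smul_eq_mul]
    ring
  rw [h1, FunLike.coe_smul, ModularForm.qExpansion_smul one_pos one_mem_strictPeriods_SL,
    FunLike.coe_sub, ModularForm.qExpansion_sub one_pos one_mem_strictPeriods_SL, coe_mcast,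
    coe_mcast, ModularForm.qExpansion_pow one_pos one_mem_strictPeriods_SL,
    ModularForm.qExpansion_pow one_pos one_mem_strictPeriods_SL]
  have h4 : qExpansion 1 E₄ ∈ FilMDComplex 4 := qExpansion_E_mem (by norm_num) ⟨2, rfl⟩
  have h6 : qExpansion 1 E₆ ∈ FilMDComplex 6 := qExpansion_E_mem (by norm_num) ⟨3, rfl⟩
  have h444 := FilMDComplex_mul_mem (FilMDComplex_mul_mem h4 h4) h4
  have h66 := FilMDComplex_mul_mem h6 h6
  norm_num only at h444 h66
  refine Submodule.smul_mem _ _ (sub_mem ?_ ?_)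
  · rwa [pow_succ, sq]
  · rwa [sq]

/-- A form vanishing at the cusp is `Δ` times a form of weight `k - 12`. -/
lemma qExpansion_mem_of_coeff_zero {k : ℕ}
    (ih : ∀ m < k, ∀ f : ModularForm 𝒮ℒ (m : ℤ), qExpansion 1 f ∈ FilMDComplex m)
    (f : ModularForm 𝒮ℒ (k : ℤ)) (hf : (qExpansion 1 f).coeff 0 = 0) :
    qExpansion 1 f ∈ FilMDComplex k := by
  rw [qExpansion_eq_qExpansion_discriminant_mul f hf]
  set g := CuspForm.discriminantEquiv (toCuspForm f hf)
  rcases lt_or_ge k 12 with h | h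
  · have : (g : ℍ → ℂ) = 0 := ModularFormClass.levelOne_neg_weight_eq_zero (by lia) g
    rw [this, qExpansion_zero, mul_zero]
    exact Submodule.zero_mem _
  · have hg := ih (k - 12) (by omega) (g.mcast (by lia))
    rw [coe_mcast] at hg
    have := FilMDComplex_mul_mem qExpansion_discriminant_mem hg
    rwa [Nat.add_sub_cancel' h] at this

/-- Induction on the weight in steps of `12`: all modular forms are polynomials in brackets, since
the Eisenstein series are combinations of `1` and `[k]`. -/
lemma qExpansion_mem_FilMDComplex (k : ℕ) (f : ModularForm 𝒮ℒ (k : ℤ)) :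
    qExpansion 1 f ∈ FilMDComplex k := by
  induction k using Nat.strong_induction_on with
  | _ k ih =>
  -- subtracting a multiple of a form `g` with constant coefficient `1` leaves a cusp form
  have key : ∀ g : ModularForm 𝒮ℒ (k : ℤ), (qExpansion 1 g).coeff 0 = 1 →
      qExpansion 1 g ∈ FilMDComplex k → qExpansion 1 f ∈ FilMDComplex k := by
    intro g hg hg'
    set c := (qExpansion 1 f).coeff 0
    have h : qExpansion 1 (f - c • g : ModularForm 𝒮ℒ (k : ℤ)) =
        qExpansion 1 f - c • qExpansion 1 g := by
      rw [FunLike.coe_sub, ModularForm.qExpansion_sub one_pos one_mem_strictPeriods_SL,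
        FunLike.coe_smul, ModularForm.qExpansion_smul one_pos one_mem_strictPeriods_SL]
    have h2 := qExpansion_mem_of_coeff_zero ih (f - c • g) (by
      rw [h, map_sub, map_smul, hg, smul_eq_mul, mul_one, sub_self])
    rw [h] at h2
    have := add_mem h2 (Submodule.smul_mem _ c hg')
    rwa [sub_add_cancel] at this
  rcases Nat.even_or_odd k with hk | hk
  · rcases lt_or_ge k 3 with h3 | h3
    · have : k = 0 ∨ k = 2 := by
        have := hk.two_dvd
        omega
      rcases this with rfl | rfl
      · refine key (1 : ModularForm 𝒮ℒ 0) ?_ ?_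
        · rw [ModularForm.qExpansion_one]
          simp
        · rw [ModularForm.qExpansion_one]
          exact one_mem_FilMDComplex 0
      · rw [rank_zero_iff_forall_zero.mp levelOne_weight_two_rank_zero f, FunLike.coe_zero,
          qExpansion_zero]
        exact Submodule.zero_mem _
    · exact key (E h3) (E_qExpansion_coeff_zero h3 hk) (qExpansion_E_mem h3 hk)
  · rw [ModularForm.levelOne_odd_weight_eq_zero (mod_cast hk) f, FunLike.coe_zero,
      qExpansion_zero]
    exact Submodule.zero_mem _

lemma isCuspFormExpansion_mem_FilMD {k : ℕ} {f : ℚ⟦X⟧} (hf : IsCuspFormExpansion k f) :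
    f ∈ FilMD k := by
  obtain ⟨F, hF⟩ := hf
  refine mem_FilMD_of_map_mem ?_
  rw [← hF]
  exact qExpansion_mem_FilMDComplex k (CuspForm.toModularFormₗ F)

end ModularForms

/-! ### Evaluation of power series at real numbers -/

/-- Absolute convergence of a rational power series at the real number `q`. -/
def ConvAt (q : ℝ) (f : ℚ⟦X⟧) : Prop := Summable fun n => ‖((coeff n f : ℚ) : ℝ) * q ^ n‖

lemma ConvAt.summable {q : ℝ} {f : ℚ⟦X⟧} (hf : ConvAt q f) :
    Summable fun n => ((coeff n f : ℚ) : ℝ) * q ^ n :=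
  Summable.of_norm hf

lemma ConvAt.add {q : ℝ} {f g : ℚ⟦X⟧} (hf : ConvAt q f) (hg : ConvAt q g) : ConvAt q (f + g) := by
  refine Summable.of_nonneg_of_le (fun _ => norm_nonneg _) (fun n => ?_) (Summable.add hf hg)
  rw [map_add, Rat.cast_add, add_mul]
  exact norm_add_le _ _

lemma qEval_add {q : ℝ} {f g : ℚ⟦X⟧} (hf : ConvAt q f) (hg : ConvAt q g) :
    qEval (f + g) q = qEval f q + qEval g q := by
  rw [qEval, qEval, qEval, ← hf.summable.tsum_add hg.summable]
  refine tsum_congr fun n => ?_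
  rw [map_add, Rat.cast_add, add_mul]

lemma ConvAt.smul {q : ℝ} {f : ℚ⟦X⟧} (c : ℚ) (hf : ConvAt q f) : ConvAt q (c • f) := by
  refine (Summable.mul_left ‖(c : ℝ)‖ hf).congr fun n => ?_
  rw [map_smul, smul_eq_mul, Rat.cast_mul, mul_assoc, norm_mul _ (_ * _)]

lemma qEval_smul (c : ℚ) (f : ℚ⟦X⟧) (q : ℝ) : qEval (c • f) q = c * qEval f q := by
  rw [qEval, qEval, ← tsum_mul_left]
  refine tsum_congr fun n => ?_
  rw [map_smul, smul_eq_mul, Rat.cast_mul, mul_assoc]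

lemma coeff_mul_cast (q : ℝ) (f g : ℚ⟦X⟧) (n : ℕ) : ((coeff n (f * g) : ℚ) : ℝ) * q ^ n =
    ∑ p ∈ Finset.HasAntidiagonal.antidiagonal n,
      ((coeff p.1 f : ℚ) : ℝ) * q ^ p.1 * (((coeff p.2 g : ℚ) : ℝ) * q ^ p.2) := by
  rw [coeff_mul, Rat.cast_sum, Finset.sum_mul]
  refine Finset.sum_congr rfl fun p hp => ?_
  rw [← Finset.HasAntidiagonal.mem_antidiagonal.mp hp]
  push_cast
  ring

lemma ConvAt.mul {q : ℝ} {f g : ℚ⟦X⟧} (hf : ConvAt q f) (hg : ConvAt q g) : ConvAt q (f * g) := by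
  have := summable_norm_sum_mul_antidiagonal_of_summable_norm hf hg
  simp only [← coeff_mul_cast] at this
  exact this

lemma qEval_mul {q : ℝ} {f g : ℚ⟦X⟧} (hf : ConvAt q f) (hg : ConvAt q g) :
    qEval (f * g) q = qEval f q * qEval g q := by
  rw [qEval, qEval, qEval, tsum_mul_tsum_eq_tsum_sum_antidiagonal_of_summable_norm hf hg]
  exact tsum_congr fun n => coeff_mul_cast q f g n

lemma convAt_monomial (q : ℝ) (n : ℕ) (a : ℚ) : ConvAt q (monomial n a) := by
  refine summable_of_ne_finset_zero (s := {n}) fun m hm => ?_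
  rw [Finset.mem_singleton] at hm
  simp [coeff_monomial, hm]

lemma qEval_monomial (q : ℝ) (n : ℕ) (a : ℚ) : qEval (monomial n a) q = a * q ^ n := by
  rw [qEval, tsum_eq_single n]
  · simp
  · intro m hm
    simp [coeff_monomial, hm]

lemma convAt_polynomial (q : ℝ) (p : Polynomial ℚ) :
    ConvAt q (p : ℚ⟦X⟧) ∧ qEval (p : ℚ⟦X⟧) q = Polynomial.aeval q p := by
  induction p using Polynomial.induction_on' with
  | add p p' h h' =>
    rw [Polynomial.coe_add, map_add]
    exact ⟨h.1.add h'.1, by rw [qEval_add h.1 h'.1, h.2, h'.2]⟩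
  | monomial n a =>
    rw [Polynomial.coe_monomial, Polynomial.aeval_monomial]
    exact ⟨convAt_monomial q n a, qEval_monomial q n a⟩

lemma convAt_one (q : ℝ) : ConvAt q 1 := by
  simpa using (convAt_polynomial q 1).1

lemma qEval_one (q : ℝ) : qEval 1 q = 1 := by
  simpa using (convAt_polynomial q 1).2

lemma convAt_sum {q : ℝ} {ι : Type*} (s : Finset ι) (f : ι → ℚ⟦X⟧)
    (hf : ∀ i ∈ s, ConvAt q (f i)) :
    ConvAt q (∑ i ∈ s, f i) ∧ qEval (∑ i ∈ s, f i) q = ∑ i ∈ s, qEval (f i) q := by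
  classical
  induction s using Finset.induction_on with
  | empty =>
    have := convAt_polynomial q 0
    simpa using this
  | insert i s hi ih =>
    have h1 := hf i (Finset.mem_insert_self i s)
    have h2 := ih fun j hj => hf j (Finset.mem_insert_of_mem hj)
    rw [Finset.sum_insert hi, Finset.sum_insert hi]
    exact ⟨h1.add h2.1, by rw [qEval_add h1 h2.1, h2.2]⟩

lemma convAt_pow {q : ℝ} {f : ℚ⟦X⟧} (hf : ConvAt q f) (n : ℕ) :
    ConvAt q (f ^ n) ∧ qEval (f ^ n) q = qEval f q ^ n := by
  induction n with
  | zero => simpa using ⟨convAt_one q, qEval_one q⟩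
  | succ n ih =>
    rw [pow_succ, pow_succ]
    exact ⟨ih.1.mul hf, by rw [qEval_mul ih.1 hf, ih.2]⟩

lemma qEval_nonneg {q : ℝ} (hq : 0 ≤ q) {f : ℚ⟦X⟧} (hf : ∀ n, 0 ≤ coeff n f) : 0 ≤ qEval f q :=
  tsum_nonneg fun n => mul_nonneg (by exact_mod_cast hf n) (pow_nonneg hq n)

lemma convAt_powSeries {q : ℝ} (hq : ‖q‖ < 1) (r : ℕ) : ConvAt q (powSeries r) := by
  refine Summable.of_nonneg_of_le (fun _ => norm_nonneg _) (fun n => ?_)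
    (summable_norm_pow_mul_geometric_of_norm_lt_one r hq)
  rw [coeff_powSeries]
  split_ifs
  · rw [Rat.cast_zero, zero_mul, norm_zero]
    exact norm_nonneg _
  · simp

lemma convAt_expand {q : ℝ} {f : ℚ⟦X⟧} (p : ℕ) (hp : p ≠ 0) (hf : ConvAt (q ^ p) f) :
    ConvAt q (expand p hp f) ∧ qEval (expand p hp f) q = qEval f (q ^ p) := by
  have hinj : Function.Injective fun m : ℕ => p * m := fun a b h =>
    Nat.eq_of_mul_eq_mul_left (Nat.pos_of_ne_zero hp) h
  have h0 : ∀ n ∉ Set.range fun m : ℕ => p * m,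
      ((coeff n (expand p hp f) : ℚ) : ℝ) * q ^ n = 0 := by
    intro n hn
    rw [coeff_expand_of_not_dvd, Rat.cast_zero, zero_mul]
    rintro ⟨m, rfl⟩
    exact hn ⟨m, rfl⟩
  have h1 : ∀ m, ((coeff (p * m) (expand p hp f) : ℚ) : ℝ) * q ^ (p * m) =
      ((coeff m f : ℚ) : ℝ) * (q ^ p) ^ m := by
    intro m
    rw [coeff_expand_mul, pow_mul]
  constructor
  · refine (hinj.summable_iff (f := fun n => ‖((coeff n (expand p hp f) : ℚ) : ℝ) * q ^ n‖)
      fun n hn => by rw [h0 n hn, norm_zero]).mp ?_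
    refine Summable.congr hf fun m => ?_
    simp only [Function.comp_apply, h1]
  · rw [qEval, qEval, ← hinj.tsum_eq]
    · exact tsum_congr h1
    · intro n hn
      by_contra h
      exact hn (h0 n h)

lemma coeff_truncBracket_nonneg (w : List ℕ) (N n : ℕ) : 0 ≤ coeff n (truncBracket w N) := by
  induction w generalizing N n with
  | nil =>
    rw [truncBracket_nil, Pi.one_apply, coeff_one]
    split_ifs <;> norm_num
  | cons r w ih =>
    rw [truncBracket_cons, kernelSum_apply, map_sum]
    refine Finset.sum_nonneg fun u _ => ?_
    rw [coeff_mul]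
    refine Finset.sum_nonneg fun p _ => mul_nonneg ?_ (ih u _)
    rw [coeff_partSeries]
    split_ifs <;> positivity

lemma coeff_truncBracket_le (w : List ℕ) (N n : ℕ) :
    coeff n (truncBracket w N) ≤ coeff n (wordBracket w) := by
  rcases le_total n N with h | h
  · rw [coeff_wordBracket w h]
  · rw [coeff_wordBracket w le_rfl]
    cases w with
    | nil => rfl
    | cons r w =>
      rw [truncBracket_cons, kernelSum_apply, kernelSum_apply, map_sum, map_sum]
      refine Finset.sum_le_sum_of_subset_of_nonneg (Finset.range_subset_range.mpr h) ?_
      intro u _ _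
      rw [coeff_mul]
      refine Finset.sum_nonneg fun p _ => mul_nonneg ?_ (coeff_truncBracket_nonneg w u _)
      rw [coeff_partSeries]
      split_ifs <;> positivity

lemma coeff_wordBracket_nonneg (w : List ℕ) (n : ℕ) : 0 ≤ coeff n (wordBracket w) := by
  rw [coeff_wordBracket w le_rfl]
  exact coeff_truncBracket_nonneg w n n

/-! ### Estimates for a single part -/

/-- The polynomial `(1 - X) ^ (r + 1) * ∑_{v ≥ 1} v ^ r X ^ v`, an Eulerian polynomial
times `X`. -/
noncomputable def eulerPoly : ℕ → Polynomial ℚ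
  | 0 => Polynomial.X
  | r + 1 => (1 - Polynomial.X) * (Polynomial.X * Polynomial.derivative (eulerPoly r)) +
      ((r + 1 : ℕ) : Polynomial ℚ) * Polynomial.X * eulerPoly r

lemma eulerPoly_coe (r : ℕ) : (1 - X) ^ (r + 1) * powSeries r = (eulerPoly r : ℚ⟦X⟧) := by
  induction r with
  | zero =>
    rw [eulerPoly, Polynomial.coe_X, zero_add, pow_one, mul_comm, powSeries_zero_mul]
  | succ r ih =>
    have h := congrArg qDeriv ih
    have h1 : qDeriv ((1 - X : ℚ⟦X⟧) ^ (r + 1)) =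
        -(((r + 1 : ℕ) : ℚ⟦X⟧) * X * (1 - X) ^ r) := by
      have h2 := qDeriv_one_sub_X
      rw [qDeriv] at h2
      rw [qDeriv, Derivation.leibniz_pow, Nat.add_sub_cancel, smul_eq_mul, nsmul_eq_mul]
      linear_combination ((r + 1 : ℕ) : ℚ⟦X⟧) * (1 - X) ^ r * h2
    rw [qDeriv_mul, qDeriv_powSeries, h1] at h
    have h3 : qDeriv (eulerPoly r : ℚ⟦X⟧) =
        ((Polynomial.X * Polynomial.derivative (eulerPoly r) : Polynomial ℚ) : ℚ⟦X⟧) := by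
      rw [qDeriv, derivative_coe, Polynomial.coe_mul, Polynomial.coe_X]
    rw [h3] at h
    have h4 : ((((r + 1 : ℕ) : Polynomial ℚ)) : ℚ⟦X⟧) = ((r + 1 : ℕ) : ℚ⟦X⟧) :=
      map_natCast Polynomial.coeToPowerSeries.ringHom (r + 1)
    rw [eulerPoly, Polynomial.coe_add, Polynomial.coe_mul, Polynomial.coe_mul, Polynomial.coe_mul,
      Polynomial.coe_mul, h4, Polynomial.coe_sub, Polynomial.coe_one, Polynomial.coe_X, ← ih]
    rw [Polynomial.coe_mul, Polynomial.coe_X] at h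
    linear_combination (1 - X) * h

lemma eval_one_eulerPoly (r : ℕ) : (eulerPoly r).eval 1 = r.factorial := by
  induction r with
  | zero => simp [eulerPoly]
  | succ r ih =>
    simp [eulerPoly, ih, Nat.factorial_succ]

lemma eval_zero_eulerPoly (r : ℕ) : (eulerPoly r).eval 0 = 0 := by
  cases r <;> simp [eulerPoly]

/-- A polynomial with a zero at `a` is bounded on `[0, 1]` by a multiple of the distance
to `a`. -/
lemma exists_abs_eval_le (p : Polynomial ℝ) (a : ℝ) (ha : p.eval a = 0) :
    ∃ C, 0 ≤ C ∧ ∀ x ∈ Set.Icc (0 : ℝ) 1, |p.eval x| ≤ C * |x - a| := by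
  obtain ⟨p', rfl⟩ := Polynomial.dvd_iff_isRoot.mpr ha
  obtain ⟨C, hC⟩ := isCompact_Icc.exists_bound_of_continuousOn
    (f := fun x => p'.eval x) (s := Set.Icc (0 : ℝ) 1) p'.continuous.continuousOn
  refine ⟨C, (norm_nonneg _).trans (hC 0 ⟨le_rfl, zero_le_one⟩), fun x hx => ?_⟩
  rw [Polynomial.eval_mul, abs_mul, mul_comm]
  refine mul_le_mul (hC x hx) ?_ (abs_nonneg _) ((norm_nonneg _).trans (hC x hx))
  simp

lemma exists_eulerPoly_bound (r : ℕ) : ∃ C : ℝ, 0 ≤ C ∧ ∀ x ∈ Set.Icc (0 : ℝ) 1,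
    |Polynomial.aeval x (eulerPoly r)| ≤ C * x ∧
      |Polynomial.aeval x (eulerPoly r) - r.factorial| ≤ C * (1 - x) := by
  set p := (eulerPoly r).map (algebraMap ℚ ℝ) with hp
  have e : ∀ x : ℝ, Polynomial.aeval x (eulerPoly r) = p.eval x := fun x =>
    (Polynomial.eval_map_algebraMap (eulerPoly r) x).symm
  obtain ⟨C₁, h1, h1'⟩ := exists_abs_eval_le p 0 (by
    have := Polynomial.eval_map_apply (f := algebraMap ℚ ℝ) (p := eulerPoly r) 0
    rw [map_zero, eval_zero_eulerPoly, map_zero] at this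
    exact this)
  obtain ⟨C₂, h2, h2'⟩ := exists_abs_eval_le (p - Polynomial.C (r.factorial : ℝ)) 1 (by
    have := Polynomial.eval_map_apply (f := algebraMap ℚ ℝ) (p := eulerPoly r) 1
    rw [map_one, eval_one_eulerPoly, map_natCast] at this
    rw [Polynomial.eval_sub, Polynomial.eval_C, hp, this, sub_self])
  refine ⟨max C₁ C₂, h1.trans (le_max_left _ _), fun x hx => ⟨?_, ?_⟩⟩
  · rw [e]
    refine (h1' x hx).trans ?_
    rw [sub_zero, abs_of_nonneg hx.1]
    exact mul_le_mul_of_nonneg_right (le_max_left _ _) hx.1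
  · have := h2' x hx
    rw [Polynomial.eval_sub, Polynomial.eval_C, ← e] at this
    refine this.trans ?_
    rw [abs_sub_comm, abs_of_nonneg (sub_nonneg.mpr hx.2)]
    exact mul_le_mul_of_nonneg_right (le_max_right _ _) (sub_nonneg.mpr hx.2)

/-- The `q`-integer `1 + q + ⋯ + q ^ (n - 1)`. -/
noncomputable def qInt (q : ℝ) (n : ℕ) : ℝ := ∑ i ∈ Finset.range n, q ^ i

lemma qInt_mul (q : ℝ) (n : ℕ) : (1 - q) * qInt q n = 1 - q ^ n := mul_neg_geom_sum q n

lemma qInt_le {q : ℝ} (hq : q ∈ Set.Ioo (0 : ℝ) 1) (n : ℕ) : qInt q n ≤ n := by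
  have : qInt q n ≤ ∑ _i ∈ Finset.range n, (1 : ℝ) :=
    Finset.sum_le_sum fun i _ => pow_le_one₀ hq.1.le hq.2.le
  simpa using this

lemma one_le_qInt_succ {q : ℝ} (hq : q ∈ Set.Ioo (0 : ℝ) 1) (u : ℕ) : 1 ≤ qInt q (u + 1) := by
  rw [qInt, Finset.sum_range_succ']
  have : 0 ≤ ∑ i ∈ Finset.range u, q ^ (i + 1) := Finset.sum_nonneg fun i _ => pow_nonneg hq.1.le _
  simpa using this

/-- The mean of `1, q, …, q ^ (n - 1)` is at least `q ^ (n / 2)`; here `y = √q`. -/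
lemma mul_pow_le_qInt {y : ℝ} (hy : y ∈ Set.Ioo (0 : ℝ) 1) (n : ℕ) :
    n * y ^ n ≤ qInt (y ^ 2) n := by
  have h1 : 2 * qInt (y ^ 2) n =
      ∑ i ∈ Finset.range n, ((y ^ 2) ^ i + (y ^ 2) ^ (n - 1 - i)) := by
    rw [Finset.sum_add_distrib, Finset.sum_range_reflect (fun i => (y ^ 2) ^ i) n, qInt]
    ring
  have h2 : ∑ _i ∈ Finset.range n, 2 * y ^ n ≤
      ∑ i ∈ Finset.range n, ((y ^ 2) ^ i + (y ^ 2) ^ (n - 1 - i)) := by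
    refine Finset.sum_le_sum fun i hi => ?_
    rw [Finset.mem_range] at hi
    have h3 : y ^ n ≤ y ^ i * y ^ (n - 1 - i) := by
      rw [← pow_add]
      exact pow_le_pow_of_le_one hy.1.le hy.2.le (by omega)
    have h4 := sq_nonneg (y ^ i - y ^ (n - 1 - i))
    rw [← pow_mul, ← pow_mul, mul_comm 2 i, mul_comm 2 (n - 1 - i), pow_mul, pow_mul]
    nlinarith
  rw [← h1, Finset.sum_const, Finset.card_range, nsmul_eq_mul] at h2
  linarith

lemma sqrt_mem_Ioo {q : ℝ} (hq : q ∈ Set.Ioo (0 : ℝ) 1) : √q ∈ Set.Ioo (0 : ℝ) 1 :=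
  ⟨Real.sqrt_pos.mpr hq.1, (Real.sqrt_lt' one_pos).mpr (by simpa using hq.2)⟩

lemma norm_lt_one_of_mem_Ioo {q : ℝ} (hq : q ∈ Set.Ioo (0 : ℝ) 1) : ‖q‖ < 1 := by
  rw [Real.norm_eq_abs, abs_of_pos hq.1]
  exact hq.2

lemma pow_succ_mem_Ioo {q : ℝ} (hq : q ∈ Set.Ioo (0 : ℝ) 1) (u : ℕ) :
    q ^ (u + 1) ∈ Set.Ioo (0 : ℝ) 1 :=
  ⟨pow_pos hq.1 _, pow_lt_one₀ hq.1.le hq.2 u.succ_ne_zero⟩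

lemma convAt_partSeries {q : ℝ} (hq : q ∈ Set.Ioo (0 : ℝ) 1) (r u : ℕ) :
    ConvAt q (partSeries r u) :=
  (convAt_expand _ _ (convAt_powSeries (norm_lt_one_of_mem_Ioo (pow_succ_mem_Ioo hq u)) r)).1

/-- The contribution `(1 - q) ^ (r + 1) ∑_{v ≥ 1} v ^ r q ^ (u + 1) v` of the part `u + 1`. -/
noncomputable def partVal (r : ℕ) (q : ℝ) (u : ℕ) : ℝ :=
  (1 - q) ^ (r + 1) * qEval (partSeries r u) q

lemma partVal_nonneg {q : ℝ} (hq : q ∈ Set.Ioo (0 : ℝ) 1) (r u : ℕ) : 0 ≤ partVal r q u := by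
  refine mul_nonneg (pow_nonneg (sub_nonneg.mpr hq.2.le) _) (qEval_nonneg hq.1.le fun n => ?_)
  rw [coeff_partSeries]
  split_ifs <;> positivity

lemma partVal_eq {q : ℝ} (hq : q ∈ Set.Ioo (0 : ℝ) 1) (r u : ℕ) : partVal r q u =
    Polynomial.aeval (q ^ (u + 1)) (eulerPoly r) / qInt q (u + 1) ^ (r + 1) := by
  have hx := pow_succ_mem_Ioo hq u
  have hc := convAt_powSeries (norm_lt_one_of_mem_Ioo hx) r
  have h0 : (0 : ℝ) < qInt q (u + 1) := one_pos.trans_le (one_le_qInt_succ hq u)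
  have h1 : ((1 - Polynomial.X : Polynomial ℚ) : ℚ⟦X⟧) = 1 - X := by simp
  have h2 : qEval ((1 - X) ^ (r + 1) * powSeries r) (q ^ (u + 1)) =
      (1 - q ^ (u + 1)) ^ (r + 1) * qEval (powSeries r) (q ^ (u + 1)) := by
    have h3 := convAt_polynomial (q ^ (u + 1)) (1 - Polynomial.X)
    have h4 := convAt_pow h3.1 (r + 1)
    rw [h1] at h3 h4
    rw [qEval_mul h4.1 hc, h4.2, h3.2]
    simp
  rw [eulerPoly_coe, (convAt_polynomial _ _).2] at h2
  rw [h2, partVal, partSeries, (convAt_expand _ _ hc).2, ← qInt_mul, mul_pow]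
  field_simp

/-- The decay exponent `min (r + 1) 2` of the contribution of a part. -/
lemma exists_partVal_le (r : ℕ) : ∃ C : ℝ, 0 ≤ C ∧ ∀ q ∈ Set.Ioo (0 : ℝ) 1, ∀ u : ℕ,
    partVal r q u ≤ C * q ^ (u + 1) ∧ partVal r q u ≤ C / ((u : ℝ) + 1) ^ min (r + 1) 2 := by
  obtain ⟨C, hC, h⟩ := exists_eulerPoly_bound r
  refine ⟨C, hC, fun q hq u => ?_⟩
  have hx := pow_succ_mem_Ioo hq u
  have h1 := one_le_qInt_succ hq u
  have h0 : (0 : ℝ) < qInt q (u + 1) := one_pos.trans_le h1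
  have h2 : partVal r q u ≤ C * q ^ (u + 1) / qInt q (u + 1) ^ (r + 1) := by
    rw [partVal_eq hq]
    exact div_le_div_of_nonneg_right ((le_abs_self _).trans (h _ ⟨hx.1.le, hx.2.le⟩).1)
      (pow_nonneg h0.le _)
  have hCx : 0 ≤ C * q ^ (u + 1) := mul_nonneg hC hx.1.le
  refine ⟨h2.trans (div_le_self hCx (one_le_pow₀ h1)), h2.trans ?_⟩
  have hm := mul_pow_le_qInt (sqrt_mem_Ioo hq) (u + 1)
  rw [Real.sq_sqrt hq.1.le] at hm
  have hy := sqrt_mem_Ioo hq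
  set m := min (r + 1) 2 with hm'
  have hm1 : m ≤ r + 1 := min_le_left _ _
  have hm2 : m ≤ 2 := min_le_right _ _
  have hu : (0 : ℝ) < (u : ℝ) + 1 := by positivity
  have h3 : C * q ^ (u + 1) / qInt q (u + 1) ^ (r + 1) ≤ C * q ^ (u + 1) / qInt q (u + 1) ^ m :=
    div_le_div_of_nonneg_left hCx (pow_pos h0 _) (pow_le_pow_right₀ h1 hm1)
  refine h3.trans ?_
  rw [div_le_div_iff₀ (pow_pos h0 _) (pow_pos hu _), mul_assoc]
  refine mul_le_mul_of_nonneg_left ?_ hC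
  have h4 : q ^ (u + 1) ≤ (√q ^ (u + 1)) ^ m := by
    calc q ^ (u + 1) = (√q ^ (u + 1)) ^ 2 := by
          rw [← pow_mul, mul_comm, pow_mul, Real.sq_sqrt hq.1.le]
      _ ≤ _ := pow_le_pow_of_le_one (pow_nonneg hy.1.le _)
          (pow_le_one₀ hy.1.le hy.2.le) hm2
  calc q ^ (u + 1) * ((u : ℝ) + 1) ^ m ≤ (√q ^ (u + 1)) ^ m * ((u : ℝ) + 1) ^ m :=
        mul_le_mul_of_nonneg_right h4 (pow_nonneg hu.le _)
    _ = (((u + 1 : ℕ) : ℝ) * √q ^ (u + 1)) ^ m := by rw [← mul_pow]; push_cast; ring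
    _ ≤ qInt q (u + 1) ^ m := pow_le_pow_left₀ (by positivity) hm m

/-- The limit `r! / n ^ (r + 1)` of `partVal` as `q → 1`, for the part `n = u + 1`. -/
noncomputable def partLim (r u : ℕ) : ℝ := r.factorial / ((u : ℝ) + 1) ^ (r + 1)

lemma partLim_nonneg (r u : ℕ) : 0 ≤ partLim r u := by
  unfold partLim
  positivity

lemma partLim_le (r u : ℕ) : partLim r u ≤ r.factorial / ((u : ℝ) + 1) ^ min (r + 1) 2 :=
  div_le_div_of_nonneg_left (by positivity) (by positivity)
    (pow_le_pow_right₀ (by linarith [Nat.cast_nonneg (α := ℝ) u]) (min_le_left _ _))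

/-- The rate of convergence of `partVal` to its limit. The exponent `1 / 2` is small enough to
leave summable terms below. -/
lemma exists_partVal_sub_le (r : ℕ) : ∃ C : ℝ, 0 ≤ C ∧ ∀ q ∈ Set.Ioo (0 : ℝ) 1, ∀ u : ℕ,
    |partVal r q u - partLim r u| ≤
      C * √(((u : ℝ) + 1) * (1 - q)) / ((u : ℝ) + 1) ^ min (r + 1) 2 := by
  obtain ⟨C₁, hC₁, h1⟩ := exists_partVal_le r
  obtain ⟨C₂, hC₂, h2⟩ := exists_eulerPoly_bound r
  refine ⟨2 * (C₁ + r.factorial) + (C₂ * 2 ^ (r + 1) + r.factorial * (2 ^ (r + 1) * (r + 1))),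
    by positivity, fun q hq u => ?_⟩
  set n : ℝ := (u : ℝ) + 1 with hn
  have hn1 : 1 ≤ n := by linarith [Nat.cast_nonneg (α := ℝ) u]
  have hn0 : 0 < n := by linarith
  set m := min (r + 1) 2
  set ε := n * (1 - q) with hε
  have hε0 : 0 ≤ ε := mul_nonneg hn0.le (by linarith [hq.2])
  rcases le_or_gt (1 / 2) ε with h | h
  · -- both terms are bounded by `n ^ (-m)`, and `√ε` is bounded below
    have hs : 1 ≤ 2 * √ε := by
      have : (1 / 2 : ℝ) ≤ √ε := Real.le_sqrt_of_sq_le (by linarith)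
      linarith
    have h3 : |partVal r q u - partLim r u| ≤ (C₁ + r.factorial) / n ^ m := by
      refine abs_sub_le_of_nonneg_of_le (partVal_nonneg hq r u) ?_ (partLim_nonneg r u) ?_
      · refine ((h1 q hq u).2).trans (div_le_div_of_nonneg_right ?_ (pow_nonneg hn0.le _))
        linarith [Nat.cast_nonneg (α := ℝ) r.factorial]
      · refine (partLim_le r u).trans (div_le_div_of_nonneg_right ?_ (pow_nonneg hn0.le _))
        linarith
    refine h3.trans (div_le_div_of_nonneg_right ?_ (pow_nonneg hn0.le _))
    have h4 : 0 ≤ C₁ + r.factorial := by positivity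
    have h5 : 0 ≤ (C₂ * 2 ^ (r + 1) + r.factorial * (2 ^ (r + 1) * (r + 1))) * √ε := by positivity
    nlinarith
  · -- for `ε < 1 / 2` both `q ^ n` and `qInt q n / n` are `1 + O(ε)`
    have hx := pow_succ_mem_Ioo hq u
    set x := q ^ (u + 1) with hxdef
    set φ := Polynomial.aeval x (eulerPoly r) with hφ
    have hQ1 := one_le_qInt_succ hq u
    set Q := qInt q (u + 1) with hQ
    have hQ0 : 0 < Q := by linarith
    have hQn : Q ≤ n := by
      have := qInt_le hq (u + 1)
      push_cast at this
      exact this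
    have hxε : 1 - x ≤ ε := by
      rw [hxdef, ← qInt_mul, hε, mul_comm]
      exact mul_le_mul_of_nonneg_right hQn (by linarith [hq.2])
    have hQx : n * (1 - ε) ≤ Q := by
      have : ∑ _i ∈ Finset.range (u + 1), x ≤ Q := Finset.sum_le_sum fun i hi =>
        pow_le_pow_of_le_one hq.1.le hq.2.le (Finset.mem_range.mp hi).le
      rw [Finset.sum_const, Finset.card_range, nsmul_eq_mul] at this
      push_cast at this
      refine le_trans (mul_le_mul_of_nonneg_left ?_ hn0.le) this
      linarith
    have hρ : n / Q ≤ 2 := by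
      rw [div_le_iff₀ hQ0]
      nlinarith
    have hρ' : 1 - ε ≤ Q / n := by
      rw [le_div_iff₀ hn0]
      linarith
    have hB : 1 - (r + 1) * ε ≤ (Q / n) ^ (r + 1) := by
      have h3 : -1 ≤ Q / n := by linarith [div_nonneg hQ0.le hn0.le]
      have := one_add_mul_sub_le_pow h3 (r + 1)
      refine le_trans ?_ this
      push_cast
      nlinarith [Nat.cast_nonneg (α := ℝ) r]
    have hρ2 : (n / Q) ^ (r + 1) ≤ 2 ^ (r + 1) := pow_le_pow_left₀ (by positivity) hρ _
    have hρ3 : (n / Q) ^ (r + 1) - 1 ≤ 2 ^ (r + 1) * ((r + 1) * ε) := by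
      have h3 : (n / Q) ^ (r + 1) * (Q / n) ^ (r + 1) = 1 := by
        rw [← mul_pow]
        field_simp
        simp
      have h4 : (n / Q) ^ (r + 1) - 1 = (n / Q) ^ (r + 1) * (1 - (Q / n) ^ (r + 1)) := by
        rw [mul_sub, h3, mul_one]
      rw [h4]
      have h5 : (0 : ℝ) ≤ (r + 1) * ε := by positivity
      calc (n / Q) ^ (r + 1) * (1 - (Q / n) ^ (r + 1))
          ≤ (n / Q) ^ (r + 1) * ((r + 1) * ε) :=
            mul_le_mul_of_nonneg_left (by linarith) (by positivity)
        _ ≤ _ := mul_le_mul_of_nonneg_right hρ2 h5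
    have hρ4 : 1 ≤ (n / Q) ^ (r + 1) := one_le_pow₀ ((one_le_div hQ0).mpr hQn)
    have hφ1 : |φ - r.factorial| ≤ C₂ * ε :=
      ((h2 x ⟨hx.1.le, hx.2.le⟩).2).trans (mul_le_mul_of_nonneg_left hxε hC₂)
    have e : partVal r q u - partLim r u =
        ((φ - r.factorial) * (n / Q) ^ (r + 1) + r.factorial * ((n / Q) ^ (r + 1) - 1)) /
          n ^ (r + 1) := by
      rw [partVal_eq hq, partLim]
      change φ / Q ^ (r + 1) - r.factorial / n ^ (r + 1) = _
      rw [div_pow]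
      field_simp
      ring
    have hnum : |(φ - r.factorial) * (n / Q) ^ (r + 1) +
        r.factorial * ((n / Q) ^ (r + 1) - 1)| ≤
        (C₂ * 2 ^ (r + 1) + r.factorial * (2 ^ (r + 1) * (r + 1))) * ε := by
      refine (abs_add_le _ _).trans ?_
      rw [abs_mul, abs_mul, abs_of_nonneg (zero_le_one.trans hρ4),
        abs_of_nonneg (sub_nonneg.mpr hρ4), Nat.abs_cast]
      have h3 := mul_le_mul hφ1 hρ2 (by positivity) (by positivity)
      have h4 := mul_le_mul_of_nonneg_left hρ3 (Nat.cast_nonneg (α := ℝ) r.factorial)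
      linarith
    have hεs : ε ≤ √ε := Real.le_sqrt_of_sq_le (by nlinarith)
    rw [e, abs_div, abs_of_pos (pow_pos hn0 _)]
    refine div_le_div₀ (by positivity) (hnum.trans ?_) (pow_pos hn0 _)
      (pow_le_pow_right₀ hn1 (min_le_left _ _))
    refine mul_le_mul ?_ hεs hε0 (by positivity)
    have : (0 : ℝ) ≤ 2 * (C₁ + r.factorial) := by positivity
    linarith

/-! ### Asymptotics of brackets as `q → 1` -/

/-- The normalised truncated bracket `(1 - q) ^ weight w * truncBracket w N`
evaluated at `q`. -/
noncomputable def truncVal (q : ℝ) : List ℕ → ℕ → ℝ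
  | [], _ => 1
  | r :: w, N => ∑ u ∈ Finset.range N, partVal r q u * truncVal q w u

/-- The truncated multiple zeta sum `∑ ∏ r_j! / u_j ^ (r_j + 1)` over
`N ≥ u_1 > ⋯ > u_l > 0`. -/
noncomputable def truncLim : List ℕ → ℕ → ℝ
  | [], _ => 1
  | r :: w, N => ∑ u ∈ Finset.range N, partLim r u * truncLim w u

lemma convAt_truncBracket {q : ℝ} (hq : q ∈ Set.Ioo (0 : ℝ) 1) (w : List ℕ) (N : ℕ) :
    ConvAt q (truncBracket w N) ∧
      (1 - q) ^ weight w * qEval (truncBracket w N) q = truncVal q w N := by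
  induction w generalizing N with
  | nil => simpa [truncBracket_nil, truncVal] using ⟨convAt_one q, qEval_one q⟩
  | cons r w ih =>
    rw [truncBracket_cons, kernelSum_apply, truncVal]
    have h := convAt_sum (q := q) (Finset.range N) (fun u => partSeries r u * truncBracket w u)
      fun u _ => (convAt_partSeries hq r u).mul (ih u).1
    refine ⟨h.1, ?_⟩
    rw [h.2, Finset.mul_sum]
    refine Finset.sum_congr rfl fun u _ => ?_
    rw [qEval_mul (convAt_partSeries hq r u) (ih u).1, ← (ih u).2, partVal, weight_cons, pow_add]
    ring

lemma truncVal_nonneg {q : ℝ} (hq : q ∈ Set.Ioo (0 : ℝ) 1) (w : List ℕ) (N : ℕ) :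
    0 ≤ truncVal q w N := by
  induction w generalizing N with
  | nil => exact zero_le_one
  | cons r w ih => exact Finset.sum_nonneg fun u _ => mul_nonneg (partVal_nonneg hq r u) (ih u)

lemma truncLim_nonneg (w : List ℕ) (N : ℕ) : 0 ≤ truncLim w N := by
  induction w generalizing N with
  | nil => exact zero_le_one
  | cons r w ih => exact Finset.sum_nonneg fun u _ => mul_nonneg (partLim_nonneg r u) (ih u)

lemma exists_truncVal_le {q : ℝ} (hq : q ∈ Set.Ioo (0 : ℝ) 1) (w : List ℕ) :
    ∃ B, ∀ N, truncVal q w N ≤ B := by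
  induction w with
  | nil => exact ⟨1, fun _ => le_rfl⟩
  | cons r w ih =>
    obtain ⟨B, hB⟩ := ih
    obtain ⟨C, hC, h⟩ := exists_partVal_le r
    have hB0 : 0 ≤ B := (truncVal_nonneg hq w 0).trans (hB 0)
    have hs : Summable fun u : ℕ => C * q ^ (u + 1) * B :=
      (((summable_nat_add_iff 1).mpr
        (summable_geometric_of_lt_one hq.1.le hq.2)).mul_left C).mul_right B
    have hnn : ∀ u : ℕ, 0 ≤ C * q ^ (u + 1) * B := fun u =>
      mul_nonneg (mul_nonneg hC (pow_nonneg hq.1.le _)) hB0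
    refine ⟨∑' u : ℕ, C * q ^ (u + 1) * B, fun N => ?_⟩
    refine le_trans ?_ (hs.sum_le_tsum (Finset.range N) fun u _ => hnn u)
    exact Finset.sum_le_sum fun u _ => mul_le_mul (h q hq u).1 (hB u) (truncVal_nonneg hq w u)
      (mul_nonneg hC (pow_nonneg hq.1.le _))

/-- Brackets converge on `(0, 1)` and are there the limits of the truncated brackets. -/
lemma convAt_wordBracket {q : ℝ} (hq : q ∈ Set.Ioo (0 : ℝ) 1) (w : List ℕ) :
    ConvAt q (wordBracket w) ∧ Tendsto (truncVal q w) atTop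
      (𝓝 ((1 - q) ^ weight w * qEval (wordBracket w) q)) := by
  obtain ⟨B, hB⟩ := exists_truncVal_le hq w
  have hq1 : (0 : ℝ) < (1 - q) ^ weight w := pow_pos (by linarith [hq.2]) _
  have hterm : ∀ n, 0 ≤ ((coeff n (wordBracket w) : ℚ) : ℝ) * q ^ n := fun n =>
    mul_nonneg (by exact_mod_cast coeff_wordBracket_nonneg w n) (pow_nonneg hq.1.le _)
  have hterm' : ∀ N n, 0 ≤ ((coeff n (truncBracket w N) : ℚ) : ℝ) * q ^ n := fun N n =>
    mul_nonneg (by exact_mod_cast coeff_truncBracket_nonneg w N n) (pow_nonneg hq.1.le _)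
  have hpart : ∀ K, ∑ n ∈ Finset.range K, ((coeff n (wordBracket w) : ℚ) : ℝ) * q ^ n ≤
      qEval (truncBracket w K) q := by
    intro K
    have h1 := (convAt_truncBracket hq w K).1.summable.sum_le_tsum (Finset.range K)
      fun n _ => hterm' K n
    refine le_trans (le_of_eq (Finset.sum_congr rfl fun n hn => ?_)) h1
    rw [coeff_wordBracket w (Finset.mem_range.mp hn).le]
  have hval : ∀ N, qEval (truncBracket w N) q = truncVal q w N / (1 - q) ^ weight w := fun N => by
    rw [← (convAt_truncBracket hq w N).2, mul_div_cancel_left₀ _ hq1.ne']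
  have hsum : Summable fun n => ((coeff n (wordBracket w) : ℚ) : ℝ) * q ^ n :=
    summable_of_sum_range_le hterm (c := B / (1 - q) ^ weight w) fun K => by
      refine (hpart K).trans ?_
      rw [hval]
      exact div_le_div_of_nonneg_right (hB K) hq1.le
  refine ⟨hsum.norm, ?_⟩
  have hle : ∀ N, qEval (truncBracket w N) q ≤ qEval (wordBracket w) q := fun N => by
    refine (convAt_truncBracket hq w N).1.summable.tsum_le_tsum (fun n => ?_) hsum
    exact mul_le_mul_of_nonneg_right (by exact_mod_cast coeff_truncBracket_le w N n)
      (pow_nonneg hq.1.le _)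
  have ht : Tendsto (fun N => qEval (truncBracket w N) q) atTop (𝓝 (qEval (wordBracket w) q)) :=
    tendsto_of_tendsto_of_tendsto_of_le_of_le hsum.hasSum.tendsto_sum_nat tendsto_const_nhds
      hpart hle
  refine (ht.const_mul ((1 - q) ^ weight w)).congr fun N => ?_
  exact (convAt_truncBracket hq w N).2

lemma convAt_of_mem_FilMD {q : ℝ} (hq : q ∈ Set.Ioo (0 : ℝ) 1) {k : ℕ} {f : ℚ⟦X⟧}
    (hf : f ∈ FilMD k) : ConvAt q f := by
  let S : Submodule ℚ ℚ⟦X⟧ :=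
    { carrier := {f | ConvAt q f}
      zero_mem' := by simpa using (convAt_polynomial q 0).1
      add_mem' := ConvAt.add
      smul_mem' := fun c _ h => ConvAt.smul c h }
  exact FilMD_le (S := S) (fun w _ => (convAt_wordBracket hq w).1) hf

/-- `∑_{n ≤ N} n ^ (s - 1) ≤ N ^ s / s` for `0 < s ≤ 1`. -/
lemma sum_rpow_le {s : ℝ} (hs : 0 < s) (hs1 : s ≤ 1) (N : ℕ) :
    ∑ u ∈ Finset.range N, ((u : ℝ) + 1) ^ (s - 1) ≤ (N : ℝ) ^ s / s := by
  induction N with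
  | zero => simp [Real.zero_rpow hs.ne']
  | succ N ih =>
    rw [Finset.sum_range_succ, Nat.cast_succ]
    have hN : (0 : ℝ) < (N : ℝ) + 1 := by positivity
    have h1 : (N : ℝ) ^ s ≤ ((N : ℝ) + 1) ^ s - s * ((N : ℝ) + 1) ^ (s - 1) := by
      have h2 := rpow_one_add_le_one_add_mul_self (s := -1 / ((N : ℝ) + 1)) (by
        rw [le_div_iff₀ hN]; linarith [Nat.cast_nonneg (α := ℝ) N]) hs.le hs1
      have h3 : (N : ℝ) = ((N : ℝ) + 1) * (1 + -1 / ((N : ℝ) + 1)) := by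
        field_simp
        ring
      have h4 : 0 ≤ 1 + -1 / ((N : ℝ) + 1) := by
        have : (0 : ℝ) ≤ N := Nat.cast_nonneg N
        rw [h3] at this
        exact nonneg_of_mul_nonneg_right this hN
      have h5 : (N : ℝ) ^ s = ((N : ℝ) + 1) ^ s * (1 + -1 / ((N : ℝ) + 1)) ^ s := by
        rw [← Real.mul_rpow hN.le h4, ← h3]
      rw [h5, Real.rpow_sub_one hN.ne']
      refine (mul_le_mul_of_nonneg_left h2 (Real.rpow_nonneg hN.le s)).trans (le_of_eq ?_)
      field_simp
      ring
    calc _ ≤ (N : ℝ) ^ s / s + ((N : ℝ) + 1) ^ (s - 1) := by linarith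
      _ ≤ (((N : ℝ) + 1) ^ s - s * ((N : ℝ) + 1) ^ (s - 1)) / s + ((N : ℝ) + 1) ^ (s - 1) := by
        gcongr
      _ = _ := by
        field_simp
        ring

/-- `∑_{n ≤ N} (C / n) n ^ s ≤ (C / s) (N + 1) ^ s`. -/
lemma sum_div_mul_rpow_le {s C : ℝ} (hs : 0 < s) (hs1 : s ≤ 1) (hC : 0 ≤ C) (N : ℕ) :
    ∑ u ∈ Finset.range N, C * (((u : ℝ) + 1) ^ s / ((u : ℝ) + 1)) ≤
      C / s * ((N : ℝ) + 1) ^ s := by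
  rw [← Finset.mul_sum]
  have h : ∀ u : ℕ, ((u : ℝ) + 1) ^ s / ((u : ℝ) + 1) = ((u : ℝ) + 1) ^ (s - 1) := fun u => by
    rw [Real.rpow_sub_one (by positivity)]
  simp_rw [h]
  have h2 : (N : ℝ) ^ s ≤ ((N : ℝ) + 1) ^ s :=
    Real.rpow_le_rpow (Nat.cast_nonneg N) (by linarith) hs.le
  calc C * ∑ u ∈ Finset.range N, ((u : ℝ) + 1) ^ (s - 1) ≤ C * ((N : ℝ) ^ s / s) :=
        mul_le_mul_of_nonneg_left (sum_rpow_le hs hs1 N) hC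
    _ ≤ C * (((N : ℝ) + 1) ^ s / s) := by gcongr
    _ = _ := by ring

lemma div_pow_min_le (r u : ℕ) {C : ℝ} (hC : 0 ≤ C) :
    C / ((u : ℝ) + 1) ^ min (r + 1) 2 ≤ C / ((u : ℝ) + 1) := by
  refine div_le_div_of_nonneg_left hC (by positivity) ?_
  conv_lhs => rw [← pow_one ((u : ℝ) + 1)]
  exact pow_le_pow_right₀ (by linarith [Nat.cast_nonneg (α := ℝ) u]) (by omega)

/-- Truncated brackets grow slower than any power of the truncation; the exponent `1 / 4` is
enough. -/
lemma exists_truncVal_truncLim_le (w : List ℕ) : ∃ C : ℝ, 0 ≤ C ∧ ∀ N : ℕ,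
    truncLim w N ≤ C * ((N : ℝ) + 1) ^ (1 / 4 : ℝ) ∧
    ∀ q ∈ Set.Ioo (0 : ℝ) 1, truncVal q w N ≤ C * ((N : ℝ) + 1) ^ (1 / 4 : ℝ) := by
  induction w with
  | nil =>
    have : ∀ N : ℕ, (1 : ℝ) ≤ 1 * ((N : ℝ) + 1) ^ (1 / 4 : ℝ) := fun N => by
      rw [one_mul]
      exact Real.one_le_rpow (by linarith [Nat.cast_nonneg (α := ℝ) N]) (by norm_num)
    exact ⟨1, zero_le_one, fun N => ⟨this N, fun q _ => this N⟩⟩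
  | cons r w ih =>
    obtain ⟨C, hC, h⟩ := ih
    obtain ⟨D, hD, h'⟩ := exists_partVal_le r
    set E := max D r.factorial with hE
    have hE0 : 0 ≤ E := hD.trans (le_max_left _ _)
    have key : ∀ (a b : ℕ → ℝ), (∀ u, 0 ≤ a u) → (∀ u, 0 ≤ b u) →
        (∀ u, a u ≤ E / ((u : ℝ) + 1)) →
        (∀ u, b u ≤ C * ((u : ℝ) + 1) ^ (1 / 4 : ℝ)) → ∀ N,
        ∑ u ∈ Finset.range N, a u * b u ≤ E * C / (1 / 4) * ((N : ℝ) + 1) ^ (1 / 4 : ℝ) := by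
      intro a b ha hb hab hbb N
      refine le_trans (Finset.sum_le_sum fun u _ => ?_) (sum_div_mul_rpow_le (by norm_num)
        (by norm_num) (mul_nonneg hE0 hC) N)
      refine (mul_le_mul (hab u) (hbb u) (hb u) (by positivity)).trans (le_of_eq ?_)
      ring
    refine ⟨E * C / (1 / 4), by positivity, fun N => ⟨?_, fun q hq => ?_⟩⟩
    · refine key _ _ (partLim_nonneg r) (truncLim_nonneg w) (fun u => ?_) (fun u => (h u).1) N
      refine ((partLim_le r u).trans (div_pow_min_le r u (Nat.cast_nonneg _))).trans ?_
      exact div_le_div_of_nonneg_right (le_max_right _ _) (by positivity)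
    · refine key _ _ (partVal_nonneg hq r) (truncVal_nonneg hq w) (fun u => ?_)
        (fun u => (h u).2 q hq) N
      refine ((h' q hq u).2.trans (div_pow_min_le r u hD)).trans ?_
      exact div_le_div_of_nonneg_right (le_max_left _ _) (by positivity)

/-- The difference of two products, one factor at a time. -/
lemma abs_mul_sub_mul_le {a b c d A B C D : ℝ} (h1 : |a - c| ≤ A) (h2 : |b| ≤ B) (h3 : |c| ≤ C)
    (h4 : |b - d| ≤ D) : |a * b - c * d| ≤ A * B + C * D := by
  have e : a * b - c * d = (a - c) * b + c * (b - d) := by ring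
  rw [e]
  refine (abs_add_le _ _).trans (add_le_add ?_ ?_)
  · rw [abs_mul]
    exact mul_le_mul h1 h2 (abs_nonneg _) ((abs_nonneg _).trans h1)
  · rw [abs_mul]
    exact mul_le_mul h3 h4 (abs_nonneg _) ((abs_nonneg _).trans h3)

lemma sqrt_mul_rpow {n : ℝ} (hn : 0 < n) (δ : ℝ) :
    √(n * δ) * n ^ (1 / 4 : ℝ) = √δ * n ^ (3 / 4 : ℝ) := by
  rw [Real.sqrt_mul hn.le, Real.sqrt_eq_rpow n, show (3 / 4 : ℝ) = 1 / 2 + 1 / 4 by norm_num,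
    Real.rpow_add hn]
  ring

/-- Each summand of a truncated bracket converges with rate `√(1 - q)`, given the rate for the
inner sum. -/
lemma exists_partVal_mul_truncVal_sub_le (r : ℕ) (w : List ℕ) {C : ℝ} (hC : 0 ≤ C)
    (h : ∀ q ∈ Set.Ioo (0 : ℝ) 1, ∀ N : ℕ,
      |truncVal q w N - truncLim w N| ≤ C * √(1 - q) * ((N : ℝ) + 1) ^ (3 / 4 : ℝ)) :
    ∃ D : ℝ, 0 ≤ D ∧ ∀ q ∈ Set.Ioo (0 : ℝ) 1, ∀ u : ℕ,
      |partVal r q u * truncVal q w u - partLim r u * truncLim w u| ≤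
        D * √(1 - q) * (((u : ℝ) + 1) ^ (3 / 4 : ℝ) / ((u : ℝ) + 1) ^ min (r + 1) 2) := by
  obtain ⟨A, hA, hA'⟩ := exists_partVal_sub_le r
  obtain ⟨B, hB, hB'⟩ := exists_truncVal_truncLim_le w
  refine ⟨A * B + r.factorial * C, by positivity, fun q hq u => ?_⟩
  have hn : (0 : ℝ) < (u : ℝ) + 1 := by positivity
  have h1 : |truncVal q w u| ≤ B * ((u : ℝ) + 1) ^ (1 / 4 : ℝ) := by
    rw [abs_of_nonneg (truncVal_nonneg hq w u)]
    exact (hB' u).2 q hq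
  have h2 : |partLim r u| ≤ r.factorial / ((u : ℝ) + 1) ^ min (r + 1) 2 := by
    rw [abs_of_nonneg (partLim_nonneg r u)]
    exact partLim_le r u
  refine (abs_mul_sub_mul_le (hA' q hq u) h1 h2 (h q hq u)).trans (le_of_eq ?_)
  linear_combination (A * B / ((u : ℝ) + 1) ^ min (r + 1) 2) * sqrt_mul_rpow hn (1 - q)

/-- The exponent `3 / 4` is the sum of `1 / 4`, the growth of truncated brackets, and `1 / 2`, the
exponent of `n` in the rate of convergence of `partVal`. -/
lemma exists_truncVal_sub_le (w : List ℕ) : ∃ C : ℝ, 0 ≤ C ∧ ∀ q ∈ Set.Ioo (0 : ℝ) 1, ∀ N : ℕ,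
    |truncVal q w N - truncLim w N| ≤ C * √(1 - q) * ((N : ℝ) + 1) ^ (3 / 4 : ℝ) := by
  induction w with
  | nil =>
    refine ⟨0, le_rfl, fun q _ N => ?_⟩
    simp [truncVal, truncLim]
  | cons r w ih =>
    obtain ⟨C, hC, h⟩ := ih
    obtain ⟨D, hD, h'⟩ := exists_partVal_mul_truncVal_sub_le r w hC h
    refine ⟨D / (3 / 4), by positivity, fun q hq N => ?_⟩
    rw [truncVal, truncLim, ← Finset.sum_sub_distrib]
    refine (Finset.abs_sum_le_sum_abs _ _).trans ?_
    have hDq : 0 ≤ D * √(1 - q) := by positivity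
    refine le_trans (Finset.sum_le_sum fun u _ => (h' q hq u).trans ?_)
      ((sum_div_mul_rpow_le (s := 3 / 4) (by norm_num) (by norm_num) hDq N).trans
        (le_of_eq (by ring)))
    exact mul_le_mul_of_nonneg_left (div_pow_min_le r u (by positivity)) hDq

/-- An admissible bracket, times `(1 - q) ^ weight`, converges as `q → 1` with
rate `√(1 - q)`. -/
lemma exists_wordBracket_sub_le {w : List ℕ} (hw : leadingZeros w = 0) :
    ∃ Z C : ℝ, 0 ≤ C ∧ ∀ q ∈ Set.Ioo (0 : ℝ) 1,
      |(1 - q) ^ weight w * qEval (wordBracket w) q - Z| ≤ C * √(1 - q) := by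
  match w, hw with
  | [], _ =>
    refine ⟨1, 0, le_rfl, fun q _ => ?_⟩
    rw [wordBracket_nil, qEval_one]
    simp
  | (r + 1) :: w, _ =>
    obtain ⟨C, hC, h⟩ := exists_truncVal_sub_le w
    obtain ⟨D, hD, h'⟩ := exists_partVal_mul_truncVal_sub_le (r + 1) w hC h
    obtain ⟨B, hB, hB'⟩ := exists_truncVal_truncLim_le w
    have hmin : min (r + 1 + 1) 2 = 2 := by omega
    have hsum : ∀ s : ℝ, s ≤ 3 / 4 →
        Summable fun u : ℕ => ((u : ℝ) + 1) ^ s / ((u : ℝ) + 1) ^ 2 := by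
      intro s hs
      have h1 : Summable fun u : ℕ => ((u + 1 : ℕ) : ℝ) ^ (s - 2) :=
        (summable_nat_add_iff 1).mpr (Real.summable_nat_rpow.mpr (by linarith))
      refine h1.congr fun u => ?_
      have hu : (0 : ℝ) < (u : ℝ) + 1 := by positivity
      rw [Nat.cast_succ, Real.rpow_sub hu, Real.rpow_ofNat]
    -- the limit exists because the terms are `O (n ^ (1 / 4 - 2))`
    have hZ : Summable fun u => partLim (r + 1) u * truncLim w u := by
      refine Summable.of_nonneg_of_le
        (fun u => mul_nonneg (partLim_nonneg _ u) (truncLim_nonneg w u)) (fun u => ?_)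
        ((hsum (1 / 4) (by norm_num)).mul_left (((r + 1).factorial : ℝ) * B))
      have h1 := partLim_le (r + 1) u
      rw [hmin] at h1
      refine (mul_le_mul h1 (hB' u).1 (truncLim_nonneg w u) (by positivity)).trans (le_of_eq ?_)
      ring
    have hZt : Tendsto (truncLim ((r + 1) :: w)) atTop
        (𝓝 (∑' u, partLim (r + 1) u * truncLim w u)) := hZ.hasSum.tendsto_sum_nat
    set T := ∑' u : ℕ, ((u : ℝ) + 1) ^ (3 / 4 : ℝ) / ((u : ℝ) + 1) ^ 2
    refine ⟨∑' u, partLim (r + 1) u * truncLim w u, D * T, mul_nonneg hD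
      (tsum_nonneg fun u => by positivity), fun q hq => ?_⟩
    refine le_of_tendsto ((convAt_wordBracket hq _).2.sub hZt).abs (Eventually.of_forall fun N => ?_)
    rw [truncVal, truncLim, ← Finset.sum_sub_distrib]
    refine (Finset.abs_sum_le_sum_abs _ _).trans ?_
    have h1 := fun u => h' q hq u
    rw [hmin] at h1
    refine (Finset.sum_le_sum fun u _ => h1 u).trans ?_
    rw [← Finset.mul_sum]
    have h2 := (hsum (3 / 4) le_rfl).sum_le_tsum (Finset.range N) fun u _ => by positivity
    refine (mul_le_mul_of_nonneg_left h2 (by positivity)).trans (le_of_eq ?_)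
    ring

/-- Elements of `Fil^W_j(MDA)`, times `(1 - q) ^ j`, converge as `q → 1` with
rate `√(1 - q)`. -/
lemma exists_FilMDA_sub_le {j : ℕ} {g : ℚ⟦X⟧} (hg : g ∈ FilMDA j) :
    ∃ Z C : ℝ, 0 ≤ C ∧ ∀ q ∈ Set.Ioo (0 : ℝ) 1, |(1 - q) ^ j * qEval g q - Z| ≤ C * √(1 - q) := by
  let S : Submodule ℚ ℚ⟦X⟧ :=
    { carrier := {g | (∀ q ∈ Set.Ioo (0 : ℝ) 1, ConvAt q g) ∧ ∃ Z C : ℝ, 0 ≤ C ∧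
        ∀ q ∈ Set.Ioo (0 : ℝ) 1, |(1 - q) ^ j * qEval g q - Z| ≤ C * √(1 - q)}
      zero_mem' := by
        refine ⟨fun q _ => by simpa using (convAt_polynomial q 0).1, 0, 0, le_rfl, fun q _ => ?_⟩
        simp [qEval]
      add_mem' := by
        rintro f g ⟨hf, Z, C, hC, h⟩ ⟨hg, Z', C', hC', h'⟩
        refine ⟨fun q hq => (hf q hq).add (hg q hq), Z + Z', C + C', add_nonneg hC hC',
          fun q hq => ?_⟩
        rw [qEval_add (hf q hq) (hg q hq)]
        have e : (1 - q) ^ j * (qEval f q + qEval g q) - (Z + Z') =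
          ((1 - q) ^ j * qEval f q - Z) + ((1 - q) ^ j * qEval g q - Z') := by ring
        rw [e, add_mul]
        exact (abs_add_le _ _).trans (add_le_add (h q hq) (h' q hq))
      smul_mem' := by
        rintro c f ⟨hf, Z, C, hC, h⟩
        refine ⟨fun q hq => (hf q hq).smul c, c * Z, |(c : ℝ)| * C, by positivity,
          fun q hq => ?_⟩
        have e : (1 - q) ^ j * (c * qEval f q) - c * Z = c * ((1 - q) ^ j * qEval f q - Z) := by
          ring
        rw [qEval_smul, e, abs_mul, mul_assoc]
        exact mul_le_mul_of_nonneg_left (h q hq) (abs_nonneg _) }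
  refine (FilMDA_le (S := S) (fun w hw h0 => ⟨fun q hq => (convAt_wordBracket hq w).1, ?_⟩) hg).2
  obtain ⟨Z, C, hC, h⟩ := exists_wordBracket_sub_le h0
  rcases hw.eq_or_lt with rfl | hlt
  · exact ⟨Z, C, hC, h⟩
  · -- a bracket of weight less than `j` contributes the limit `0`
    refine ⟨0, C + |Z|, by positivity, fun q hq => ?_⟩
    obtain ⟨d, rfl⟩ : ∃ d, j = weight w + (d + 1) := ⟨j - weight w - 1, by omega⟩
    have hδ0 : 0 ≤ 1 - q := by linarith [hq.2]
    have hδ1 : 1 - q ≤ 1 := by linarith [hq.1]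
    have hs1 : √(1 - q) ≤ 1 := Real.sqrt_le_one.mpr hδ1
    have h1 : (1 - q) ^ (d + 1) ≤ √(1 - q) := by
      refine (pow_le_of_le_one hδ0 hδ1 d.succ_ne_zero).trans (Real.le_sqrt_of_sq_le ?_)
      nlinarith
    have h2 : |(1 - q) ^ weight w * qEval (wordBracket w) q| ≤ C + |Z| := by
      have h3 := h q hq
      have h4 := abs_sub_abs_le_abs_sub ((1 - q) ^ weight w * qEval (wordBracket w) q) Z
      nlinarith [Real.sqrt_nonneg (1 - q)]
    rw [sub_zero, pow_add, mul_right_comm, abs_mul, abs_of_nonneg (pow_nonneg hδ0 _)]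
    exact mul_le_mul h2 h1 (pow_nonneg hδ0 _) (by positivity)

lemma tendsto_sqrt_one_sub : Tendsto (fun q : ℝ => √(1 - q)) (𝓝[<] 1) (𝓝 0) := by
  have : Tendsto (fun q : ℝ => √(1 - q)) (𝓝 1) (𝓝 (√(1 - 1))) :=
    (Real.continuous_sqrt.comp (continuous_const.sub continuous_id)).tendsto 1
  rw [sub_self, Real.sqrt_zero] at this
  exact this.mono_left nhdsWithin_le_nhds

lemma Ioo_mem_nhdsLT_one : Set.Ioo (0 : ℝ) 1 ∈ 𝓝[<] (1 : ℝ) :=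
  Ioo_mem_nhdsLT zero_lt_one

lemma exists_Zmap_sub_le {j : ℕ} {g : ℚ⟦X⟧} (hg : g ∈ FilMDA j) :
    ∃ C : ℝ, 0 ≤ C ∧ ∀ q ∈ Set.Ioo (0 : ℝ) 1,
      |(1 - q) ^ j * qEval g q - Zmap j g| ≤ C * √(1 - q) := by
  obtain ⟨Z, C, hC, h⟩ := exists_FilMDA_sub_le hg
  have ht : Tendsto (fun q : ℝ => (1 - q) ^ j * qEval g q) (𝓝[<] 1) (𝓝 Z) := by
    rw [tendsto_iff_norm_sub_tendsto_zero]
    have h0 : Tendsto (fun q : ℝ => C * √(1 - q)) (𝓝[<] 1) (𝓝 0) := by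
      simpa using tendsto_sqrt_one_sub.const_mul C
    refine squeeze_zero' (Eventually.of_forall fun _ => norm_nonneg _) ?_ h0
    filter_upwards [Ioo_mem_nhdsLT_one] with q hq using h q hq
  rw [Zmap, ht.limUnder_eq]
  exact ⟨C, hC, h⟩

lemma tendsto_Zmap {j : ℕ} {g : ℚ⟦X⟧} (hg : g ∈ FilMDA j) :
    Tendsto (fun q : ℝ => (1 - q) ^ j * qEval g q) (𝓝[<] 1) (𝓝 (Zmap j g)) := by
  obtain ⟨C, _, h⟩ := exists_Zmap_sub_le hg
  rw [tendsto_iff_norm_sub_tendsto_zero]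
  have h0 : Tendsto (fun q : ℝ => C * √(1 - q)) (𝓝[<] 1) (𝓝 0) := by
    simpa using tendsto_sqrt_one_sub.const_mul C
  refine squeeze_zero' (Eventually.of_forall fun _ => norm_nonneg _) ?_ h0
  filter_upwards [Ioo_mem_nhdsLT_one] with q hq using h q hq

/-! ### Growth of the bracket `[1]` -/

/-- The normalised bracket `(1 - q) * [1]`, which grows like `-log (1 - q)`. -/
noncomputable def oneVal (q : ℝ) : ℝ := (1 - q) * qEval bracketOne q

lemma convAt_bracketOne {q : ℝ} (hq : q ∈ Set.Ioo (0 : ℝ) 1) : ConvAt q bracketOne := by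
  rw [bracketOne_eq]
  exact (convAt_wordBracket hq [0]).1

lemma tendsto_sum_partVal_zero {q : ℝ} (hq : q ∈ Set.Ioo (0 : ℝ) 1) :
    Tendsto (fun N => ∑ u ∈ Finset.range N, partVal 0 q u) atTop (𝓝 (oneVal q)) := by
  have h := (convAt_wordBracket hq [0]).2
  rw [← bracketOne_eq] at h
  simpa [truncVal, oneVal, weight] using h

lemma partVal_zero {q : ℝ} (hq : q ∈ Set.Ioo (0 : ℝ) 1) (u : ℕ) :
    partVal 0 q u = q ^ (u + 1) / qInt q (u + 1) := by
  rw [partVal_eq hq, eulerPoly, Polynomial.aeval_X, zero_add, pow_one]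

/-- The `q`-integers are at most `n`, so `(1 - q) [1]` is at least `∑ q ^ n / n`. -/
lemma neg_log_le_oneVal {q : ℝ} (hq : q ∈ Set.Ioo (0 : ℝ) 1) : -Real.log (1 - q) ≤ oneVal q := by
  have h := (Real.hasSum_pow_div_log_of_abs_lt_one (norm_lt_one_of_mem_Ioo hq)).tendsto_sum_nat
  refine le_of_tendsto_of_tendsto' h (tendsto_sum_partVal_zero hq) fun N =>
    Finset.sum_le_sum fun u _ => ?_
  rw [partVal_zero hq]
  refine div_le_div_of_nonneg_left (pow_nonneg hq.1.le _)
    (one_pos.trans_le (one_le_qInt_succ hq u)) ?_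
  exact_mod_cast qInt_le hq (u + 1)

/-- The `q`-integers are bounded below by `n q ^ (n / 2)`, so `(1 - q) [1]` is at most
`∑ q ^ (n / 2) / n`. -/
lemma oneVal_le {q : ℝ} (hq : q ∈ Set.Ioo (0 : ℝ) 1) : oneVal q ≤ -Real.log (1 - √q) := by
  have hy := sqrt_mem_Ioo hq
  have h := (Real.hasSum_pow_div_log_of_abs_lt_one (norm_lt_one_of_mem_Ioo hy)).tendsto_sum_nat
  refine le_of_tendsto_of_tendsto' (tendsto_sum_partVal_zero hq) h fun N =>
    Finset.sum_le_sum fun u _ => ?_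
  rw [partVal_zero hq, div_le_div_iff₀ (one_pos.trans_le (one_le_qInt_succ hq u)) (by positivity)]
  have h1 := mul_pow_le_qInt hy (u + 1)
  rw [Real.sq_sqrt hq.1.le] at h1
  push_cast at h1
  have h2 : q ^ (u + 1) = √q ^ (u + 1) * √q ^ (u + 1) := by
    rw [← mul_pow, Real.mul_self_sqrt hq.1.le]
  rw [h2, mul_assoc, mul_comm (√q ^ (u + 1)) ((u : ℝ) + 1)]
  exact mul_le_mul_of_nonneg_left h1 (pow_nonneg hy.1.le _)

lemma tendsto_one_sub_nhdsGT : Tendsto (fun q : ℝ => 1 - q) (𝓝[<] 1) (𝓝[>] 0) := by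
  refine tendsto_nhdsWithin_iff.mpr ⟨?_, ?_⟩
  · have : Tendsto (fun q : ℝ => 1 - q) (𝓝 1) (𝓝 (1 - 1)) :=
      (continuous_const.sub continuous_id).tendsto 1
    rw [sub_self] at this
    exact this.mono_left nhdsWithin_le_nhds
  · filter_upwards [self_mem_nhdsWithin] with q hq
    exact Set.mem_Ioi.mpr (sub_pos.mpr (Set.mem_Iio.mp hq))

lemma tendsto_sqrt_nhdsLT : Tendsto (fun q : ℝ => √q) (𝓝[<] 1) (𝓝[<] 1) := by
  refine tendsto_nhdsWithin_iff.mpr ⟨?_, ?_⟩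
  · have : Tendsto (fun q : ℝ => √q) (𝓝 1) (𝓝 (√1)) := Real.continuous_sqrt.tendsto 1
    rw [Real.sqrt_one] at this
    exact this.mono_left nhdsWithin_le_nhds
  · filter_upwards [Ioo_mem_nhdsLT_one] with q hq
    exact (sqrt_mem_Ioo hq).2

lemma tendsto_oneVal : Tendsto oneVal (𝓝[<] 1) atTop := by
  have h : Tendsto (fun q : ℝ => -Real.log (1 - q)) (𝓝[<] 1) atTop :=
    tendsto_neg_atBot_atTop.comp (Real.tendsto_log_nhdsGT_zero.comp tendsto_one_sub_nhdsGT)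
  refine tendsto_atTop_mono' _ ?_ h
  filter_upwards [Ioo_mem_nhdsLT_one] with q hq using neg_log_le_oneVal hq

lemma oneVal_nonneg {q : ℝ} (hq : q ∈ Set.Ioo (0 : ℝ) 1) : 0 ≤ oneVal q :=
  le_trans (neg_nonneg.mpr (Real.log_nonpos (by linarith [hq.2]) (by linarith [hq.1])))
    (neg_log_le_oneVal hq)

lemma tendsto_sqrt_mul_oneVal_pow (m : ℕ) :
    Tendsto (fun q : ℝ => √(1 - q) * oneVal q ^ m) (𝓝[<] 1) (𝓝 0) := by
  have h1 := (isLittleO_abs_log_rpow_rpow_nhdsGT_zero (s := -1 / 2) m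
    (by norm_num)).tendsto_div_nhds_zero
  have h2 := (h1.comp (tendsto_one_sub_nhdsGT.comp tendsto_sqrt_nhdsLT)).const_mul (√2)
  rw [mul_zero] at h2
  refine squeeze_zero' ?_ ?_ h2
  · filter_upwards [Ioo_mem_nhdsLT_one] with q hq
    exact mul_nonneg (Real.sqrt_nonneg _) (pow_nonneg (oneVal_nonneg hq) m)
  · filter_upwards [Ioo_mem_nhdsLT_one] with q hq
    have hy := sqrt_mem_Ioo hq
    have hy0 : 0 < 1 - √q := sub_pos.mpr hy.2
    have h3 : √(1 - q) ≤ √2 * √(1 - √q) := by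
      rw [← Real.sqrt_mul zero_le_two]
      refine Real.sqrt_le_sqrt ?_
      have := Real.sq_sqrt hq.1.le
      nlinarith [hy.1, hy.2]
    have h4 : oneVal q ≤ |Real.log (1 - √q)| := (oneVal_le hq).trans (neg_le_abs _)
    have h5 : oneVal q ^ m ≤ |Real.log (1 - √q)| ^ m := pow_le_pow_left₀ (oneVal_nonneg hq) h4 m
    refine (mul_le_mul h3 h5 (pow_nonneg (oneVal_nonneg hq) m) (by positivity)).trans
      (le_of_eq ?_)
    simp only [Function.comp_apply, Real.rpow_natCast]
    rw [show (-1 / 2 : ℝ) = -(1 / 2) by norm_num, Real.rpow_neg hy0.le, ← Real.sqrt_eq_rpow,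
      div_inv_eq_mul]
    ring

/-! ### The polynomial attached to an element of `Fil^W_k(MD)` -/

/-- The polynomial `P` describes the growth of `f` in weight `k`:
`(1 - q) ^ k f(q) - P ((1 - q) [1](q))` tends to `0` as `q → 1`. -/
def IsGrowthPoly (k : ℕ) (f : ℚ⟦X⟧) (P : Polynomial ℝ) : Prop :=
  Tendsto (fun q : ℝ => (1 - q) ^ k * qEval f q - P.eval (oneVal q)) (𝓝[<] 1) (𝓝 0)

/-- As `(1 - q) [1]` tends to infinity, no nonzero polynomial in it tends to `0`. -/
lemma eq_zero_of_tendsto_eval_oneVal {P : Polynomial ℝ}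
    (h : Tendsto (fun q => P.eval (oneVal q)) (𝓝[<] 1) (𝓝 0)) : P = 0 := by
  rcases le_or_gt P.degree 0 with hd | hd
  · rw [Polynomial.eq_C_of_degree_le_zero hd] at h ⊢
    simp only [Polynomial.eval_C] at h
    rw [tendsto_nhds_unique tendsto_const_nhds h, map_zero]
  · exact absurd h.abs
      (not_tendsto_nhds_of_tendsto_atTop ((P.abs_tendsto_atTop hd).comp tendsto_oneVal) _)

lemma IsGrowthPoly.unique {k : ℕ} {f : ℚ⟦X⟧} {P P' : Polynomial ℝ} (h : IsGrowthPoly k f P)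
    (h' : IsGrowthPoly k f P') : P = P' := by
  refine sub_eq_zero.mp (eq_zero_of_tendsto_eval_oneVal ?_)
  have := Tendsto.sub h' h
  rw [sub_self] at this
  refine this.congr fun q => ?_
  rw [Polynomial.eval_sub]
  ring

lemma convAt_of_isExpansion {q : ℝ} (hq : q ∈ Set.Ioo (0 : ℝ) 1) {k j : ℕ} {f : ℚ⟦X⟧}
    {g : ℕ → ℚ⟦X⟧} (hg : IsExpansion k f g) (hj : j ≤ k) : ConvAt q (g j) :=
  convAt_of_mem_FilMD hq (FilMDA_le_FilMD j (hg.1 j hj))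

/-- The rate `√(1 - q)` at which the `g_j` converge beats the powers of the logarithmically growing
`(1 - q) [1]`, so each `(1 - q) ^ j g_j` may be replaced by its limit. Any expansion thus gives the
growth polynomial, and `Z_k^alg` is well defined. -/
lemma isGrowthPoly_of_isExpansion {k : ℕ} {f : ℚ⟦X⟧} {g : ℕ → ℚ⟦X⟧} (hg : IsExpansion k f g) :
    IsGrowthPoly k f (expansionPoly k g) := by
  have h1 : Tendsto (fun q : ℝ => ∑ j ∈ Finset.range (k + 1),
      ((1 - q) ^ j * qEval (g j) q - Zmap j (g j)) * oneVal q ^ (k - j)) (𝓝[<] 1) (𝓝 0) := by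
    rw [← Finset.sum_const_zero (s := Finset.range (k + 1)) (M := ℝ) (ι := ℕ)]
    refine tendsto_finsetSum _ fun j hj => ?_
    rw [Finset.mem_range] at hj
    obtain ⟨C, hC, h⟩ := exists_Zmap_sub_le (hg.1 j (by omega))
    have h0 := (tendsto_sqrt_mul_oneVal_pow (k - j)).const_mul C
    rw [mul_zero] at h0
    rw [tendsto_zero_iff_norm_tendsto_zero]
    refine squeeze_zero' (Eventually.of_forall fun _ => norm_nonneg _) ?_ h0
    filter_upwards [Ioo_mem_nhdsLT_one] with q hq
    rw [norm_mul, norm_pow, Real.norm_eq_abs, Real.norm_eq_abs, abs_of_nonneg (oneVal_nonneg hq),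
      ← mul_assoc]
    exact mul_le_mul_of_nonneg_right (h q hq) (pow_nonneg (oneVal_nonneg hq) _)
  refine h1.congr' ?_
  filter_upwards [Ioo_mem_nhdsLT_one] with q hq
  have h2 := convAt_sum (q := q) (Finset.range (k + 1)) (fun j => g j * bracketOne ^ (k - j))
    fun j hj => (convAt_of_isExpansion hq hg (by rw [Finset.mem_range] at hj; omega)).mul
      (convAt_pow (convAt_bracketOne hq) _).1
  rw [hg.2, h2.2, Finset.mul_sum, expansionPoly, Polynomial.eval_finsetSum,
    ← Finset.sum_sub_distrib]
  refine Finset.sum_congr rfl fun j hj => ?_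
  rw [Finset.mem_range] at hj
  rw [qEval_mul (convAt_of_isExpansion hq hg (by omega)) (convAt_pow (convAt_bracketOne hq) _).1,
    (convAt_pow (convAt_bracketOne hq) _).2, Polynomial.eval_mul, Polynomial.eval_C,
    Polynomial.eval_pow, Polynomial.eval_X, sub_mul]
  congr 1
  have hk : (1 - q) ^ k = (1 - q) ^ j * (1 - q) ^ (k - j) := by
    rw [← pow_add, Nat.add_sub_cancel' (by omega)]
  rw [hk, oneVal, mul_pow]
  ring

lemma isGrowthPoly_Zalg (k : ℕ) (f : FilMD k) : IsGrowthPoly k f (Zalg k f) := by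
  have h : ∃ g, IsExpansion k (f : ℚ⟦X⟧) g := mem_FilMD_iff.mp f.2
  rw [Zalg, dif_pos h]
  exact isGrowthPoly_of_isExpansion h.choose_spec

lemma isLinearMap_Zalg (k : ℕ) : IsLinearMap ℚ (Zalg k) where
  map_add f g := by
    refine (isGrowthPoly_Zalg k (f + g)).unique ?_
    have h := Tendsto.add (isGrowthPoly_Zalg k f) (isGrowthPoly_Zalg k g)
    rw [add_zero] at h
    refine h.congr' ?_
    filter_upwards [Ioo_mem_nhdsLT_one] with q hq
    rw [Submodule.coe_add, qEval_add (convAt_of_mem_FilMD hq f.2) (convAt_of_mem_FilMD hq g.2),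
      Polynomial.eval_add]
    ring
  map_smul c f := by
    refine (isGrowthPoly_Zalg k (c • f)).unique ?_
    have h := Tendsto.const_mul (c : ℝ) (isGrowthPoly_Zalg k f)
    rw [mul_zero] at h
    refine h.congr fun q => ?_
    rw [Submodule.coe_smul, qEval_smul, ← Rat.cast_smul_eq_qsmul ℝ c, Polynomial.eval_smul,
      smul_eq_mul]
    ring

/-- Elements of `Fil^W_k(MD)` of growth `o ((1 - q) ^ (-k))` lie in the kernel of `Z_k^alg`. -/
lemma mem_kerZalg {k : ℕ} {f : ℚ⟦X⟧} (hf : f ∈ FilMD k)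
    (h : Tendsto (fun q : ℝ => (1 - q) ^ k * qEval f q) (𝓝[<] 1) (𝓝 0)) : f ∈ kerZalg k := by
  refine ⟨hf, (isGrowthPoly_Zalg k ⟨f, hf⟩).unique ?_⟩
  simpa [IsGrowthPoly] using h

/-! ### Elements of the kernel -/

lemma tendsto_one_sub_mul_eval (P : Polynomial ℝ) :
    Tendsto (fun q : ℝ => (1 - q) * P.eval (oneVal q)) (𝓝[<] 1) (𝓝 0) := by
  simp_rw [Polynomial.eval_eq_sum_range, Finset.mul_sum]
  rw [← Finset.sum_const_zero (s := Finset.range (P.natDegree + 1)) (M := ℝ) (ι := ℕ)]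
  refine tendsto_finsetSum _ fun i _ => ?_
  have h := (tendsto_sqrt_one_sub.mul (tendsto_sqrt_mul_oneVal_pow i)).const_mul (P.coeff i)
  rw [mul_zero, mul_zero] at h
  refine h.congr' ?_
  filter_upwards [Ioo_mem_nhdsLT_one] with q hq
  rw [← mul_assoc √(1 - q), Real.mul_self_sqrt (by linarith [hq.2])]
  ring

/-- An element of `Fil^W_m(MD)` times `(1 - q) ^ m` grows only like a power of `log (1 - q)`. -/
lemma tendsto_pow_succ_mul_qEval {m : ℕ} {f : ℚ⟦X⟧} (hf : f ∈ FilMD m) :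
    Tendsto (fun q : ℝ => (1 - q) ^ (m + 1) * qEval f q) (𝓝[<] 1) (𝓝 0) := by
  have h1 := isGrowthPoly_Zalg m ⟨f, hf⟩
  have h2 : Tendsto (fun q : ℝ => 1 - q) (𝓝[<] 1) (𝓝 0) :=
    tendsto_one_sub_nhdsGT.mono_right nhdsWithin_le_nhds
  have h3 := (h2.mul h1).add (tendsto_one_sub_mul_eval (Zalg m ⟨f, hf⟩))
  rw [mul_zero, add_zero] at h3
  refine h3.congr fun q => ?_
  ring

lemma mem_kerZalg_of_mem_FilMD {m k : ℕ} (hmk : m < k) {f : ℚ⟦X⟧} (hf : f ∈ FilMD m) :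
    f ∈ kerZalg k := by
  refine mem_kerZalg (FilMD_mono hmk.le hf) ?_
  obtain ⟨d, rfl⟩ : ∃ d, k = m + 1 + d := ⟨k - (m + 1), by omega⟩
  have h1 := tendsto_pow_succ_mul_qEval hf
  rw [tendsto_zero_iff_norm_tendsto_zero] at h1 ⊢
  refine squeeze_zero' (Eventually.of_forall fun _ => norm_nonneg _) ?_ h1
  filter_upwards [Ioo_mem_nhdsLT_one] with q hq
  have h0 : 0 ≤ 1 - q := by linarith [hq.2]
  rw [pow_add, mul_right_comm, norm_mul _ ((1 - q) ^ d)]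
  refine mul_le_of_le_one_right (norm_nonneg _) ?_
  rw [Real.norm_of_nonneg (pow_nonneg h0 d)]
  exact pow_le_one₀ h0 (by linarith [hq.1])

lemma bracket_mem_FilMD {l : ℕ} (s : Fin l → ℕ) (hs : ∀ j, 1 ≤ s j) :
    bracket s ∈ FilMD (∑ j, s j) :=
  Submodule.subset_span ⟨l, s, hs, le_rfl, rfl⟩

/-- For nonnegative coefficients, `n q ^ n ≤ √q ^ n / (1 - √q)` bounds the derivative
at `q` by the value at `√q`. -/
lemma qEval_qDeriv_le {f : ℚ⟦X⟧} (hf : ∀ n, 0 ≤ coeff n f) {q : ℝ}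
    (hq : q ∈ Set.Ioo (0 : ℝ) 1) (hc : ConvAt q (qDeriv f)) (hc' : ConvAt (√q) f) :
    qEval (qDeriv f) q ≤ qEval f (√q) / (1 - √q) := by
  have hy := sqrt_mem_Ioo hq
  have hy1 : 0 < 1 - √q := sub_pos.mpr hy.2
  rw [qEval, qEval, ← tsum_div_const]
  refine hc.summable.tsum_le_tsum (fun n => ?_) (hc'.summable.div_const _)
  have h1 : (n : ℝ) * √q ^ n ≤ 1 / (1 - √q) := by
    have h2 : ∑ _i ∈ Finset.range n, √q ^ n ≤ qInt (√q) n := Finset.sum_le_sum fun i hi =>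
      pow_le_pow_of_le_one hy.1.le hy.2.le (Finset.mem_range.mp hi).le
    rw [Finset.sum_const, Finset.card_range, nsmul_eq_mul] at h2
    rw [le_div_iff₀ hy1, mul_comm]
    refine (mul_le_mul_of_nonneg_left h2 hy1.le).trans ?_
    rw [qInt_mul]
    linarith [pow_nonneg hy.1.le n]
  have h3 : q ^ n = √q ^ n * √q ^ n := by rw [← mul_pow, Real.mul_self_sqrt hq.1.le]
  have h4 : (0 : ℝ) ≤ ((coeff n f : ℚ) : ℝ) * √q ^ n :=
    mul_nonneg (by exact_mod_cast hf n) (pow_nonneg hy.1.le n)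
  rw [coeff_qDeriv, h3]
  push_cast
  calc (n : ℝ) * ((coeff n f : ℚ) : ℝ) * (√q ^ n * √q ^ n)
      = ((coeff n f : ℚ) : ℝ) * √q ^ n * (n * √q ^ n) := by ring
    _ ≤ ((coeff n f : ℚ) : ℝ) * √q ^ n * (1 / (1 - √q)) := mul_le_mul_of_nonneg_left h1 h4
    _ = _ := by ring

/-- Differentiation costs less than `(1 - q) ^ (-2)`: the value of the derivative at `q` is at most
`(1 - √q)⁻¹` times the value at `√q`, and `1 - q ≤ 2 (1 - √q)`. -/
lemma tendsto_qEval_qDeriv {m : ℕ} {f : ℚ⟦X⟧} (hf : f ∈ FilMD m) :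
    Tendsto (fun q : ℝ => (1 - q) ^ (m + 2) * qEval (qDeriv f) q) (𝓝[<] 1) (𝓝 0) := by
  let S : Submodule ℚ ℚ⟦X⟧ :=
    { carrier := {f | f ∈ FilMD m ∧
        Tendsto (fun q : ℝ => (1 - q) ^ (m + 2) * qEval (qDeriv f) q) (𝓝[<] 1) (𝓝 0)}
      zero_mem' := ⟨Submodule.zero_mem _, by simp [qDeriv, qEval]⟩
      add_mem' := by
        rintro f g ⟨hf, hf'⟩ ⟨hg, hg'⟩
        refine ⟨add_mem hf hg, ?_⟩
        have h := hf'.add hg'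
        rw [add_zero] at h
        refine h.congr' ?_
        filter_upwards [Ioo_mem_nhdsLT_one] with q hq
        rw [qDeriv_add, qEval_add (convAt_of_mem_FilMD hq (qDeriv_mem_FilMD hf))
          (convAt_of_mem_FilMD hq (qDeriv_mem_FilMD hg))]
        ring
      smul_mem' := by
        rintro c f ⟨hf, hf'⟩
        refine ⟨Submodule.smul_mem _ c hf, ?_⟩
        have h := hf'.const_mul (c : ℝ)
        rw [mul_zero] at h
        refine h.congr fun q => ?_
        rw [qDeriv_smul, qEval_smul]
        ring }
  refine (FilMD_le (S := S) (fun w hw => ?_) hf).2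
  have hwm := wordBracket_mem_FilMD hw
  refine ⟨hwm, ?_⟩
  have h1 := ((tendsto_pow_succ_mul_qEval hwm).comp tendsto_sqrt_nhdsLT).const_mul
    ((2 : ℝ) ^ (m + 2))
  rw [mul_zero] at h1
  have hnn : ∀ n, 0 ≤ coeff n (qDeriv (wordBracket w)) := fun n => by
    rw [coeff_qDeriv]
    exact mul_nonneg (Nat.cast_nonneg n) (coeff_wordBracket_nonneg w n)
  refine squeeze_zero' ?_ ?_ h1
  · filter_upwards [Ioo_mem_nhdsLT_one] with q hq
    exact mul_nonneg (pow_nonneg (by linarith [hq.2]) _) (qEval_nonneg hq.1.le hnn)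
  · filter_upwards [Ioo_mem_nhdsLT_one] with q hq
    have hy := sqrt_mem_Ioo hq
    have hy1 : 0 < 1 - √q := sub_pos.mpr hy.2
    have hq0 : 0 ≤ 1 - q := by linarith [hq.2]
    have h2 := qEval_qDeriv_le (coeff_wordBracket_nonneg w) hq
      (convAt_of_mem_FilMD hq (qDeriv_mem_FilMD hwm)) (convAt_of_mem_FilMD hy hwm)
    have h3 : 1 - q ≤ 2 * (1 - √q) := by
      have := Real.sq_sqrt hq.1.le
      nlinarith
    have h4 : (1 - q) ^ (m + 2) ≤ (2 * (1 - √q)) ^ (m + 2) := pow_le_pow_left₀ hq0 h3 _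
    refine (mul_le_mul h4 h2 (qEval_nonneg hq.1.le hnn) (by positivity)).trans (le_of_eq ?_)
    simp only [Function.comp_apply]
    rw [mul_pow, pow_succ (1 - √q) (m + 1)]
    field_simp

lemma qDeriv_mem_kerZalg {k : ℕ} (hk : 2 ≤ k) {f : ℚ⟦X⟧} (hf : f ∈ FilMD (k - 2)) :
    qDeriv f ∈ kerZalg k := by
  have h1 := qDeriv_mem_FilMD hf
  have h2 := tendsto_qEval_qDeriv hf
  rw [Nat.sub_add_cancel hk] at h1 h2
  exact mem_kerZalg h1 h2

open UpperHalfPlane ModularForm in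
/-- The value of the Fourier expansion of `F` at `q = exp (-2 π t)` is `F (i t)`. -/
lemma qEval_eq_cuspForm {k : ℕ} {f : ℚ⟦X⟧} {F : CuspForm 𝒮ℒ (k : ℤ)}
    (hF : qExpansion 1 F = PowerSeries.map (algebraMap ℚ ℂ) f) {t : ℝ} (ht : 0 < t) :
    ((qEval f (Real.exp (-2 * Real.pi * t)) : ℝ) : ℂ) =
      F ⟨Complex.I * t, by simpa using ht⟩ := by
  have : Fact (IsCusp OnePoint.infty 𝒮ℒ) :=
    ⟨Subgroup.isCusp_of_mem_strictPeriods one_pos one_mem_strictPeriods_SL⟩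
  have h := hasSum_qExpansion one_pos
    (SlashInvariantFormClass.periodic_comp_ofComplex F one_mem_strictPeriods_SL)
    (ModularFormClass.holo F) (ModularFormClass.bdd_at_infty F) ⟨Complex.I * t, by simpa using ht⟩
  rw [← h.tsum_eq, qEval, Complex.ofReal_tsum]
  refine tsum_congr fun n => ?_
  rw [hF, coeff_map]
  have e : Function.Periodic.qParam 1 (Complex.I * t) =
      ((Real.exp (-2 * Real.pi * t) : ℝ) : ℂ) := by
    rw [Function.Periodic.qParam, Complex.ofReal_exp]
    congr 1
    push_cast
    linear_combination (2 * Real.pi * t : ℂ) * Complex.I_mul_I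
  change _ = _ * Function.Periodic.qParam 1 (Complex.I * t) ^ n
  rw [e]
  push_cast
  rfl

open UpperHalfPlane ModularForm in
/-- The transformation `F (i / t) = (i t) ^ k F (i t)`. -/
lemma norm_cuspForm_inv {k : ℕ} (F : CuspForm 𝒮ℒ (k : ℤ)) {t : ℝ} (ht : 0 < t) :
    ‖F ⟨Complex.I * (t⁻¹ : ℝ), by simpa using ht⟩‖ =
      t ^ k * ‖F ⟨Complex.I * t, by simpa using ht⟩‖ := by
  set z : ℍ := ⟨Complex.I * t, by simpa using ht⟩ with hz
  have h1 : (⇑F ∣[(k : ℤ)] ModularGroup.S) z = F z :=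
    congrFun (SlashInvariantForm.slash_action_eqn F _ ⟨ModularGroup.S, rfl⟩) z
  rw [SlashInvariantForm.slash_S_apply] at h1
  have h2 : (UpperHalfPlane.mk (-z : ℂ)⁻¹ z.im_inv_neg_coe_pos) =
      ⟨Complex.I * (t⁻¹ : ℝ), by simpa using ht⟩ := by
    ext
    change (-(Complex.I * t))⁻¹ = Complex.I * (t⁻¹ : ℝ)
    have : (t : ℂ) ≠ 0 := by exact_mod_cast ht.ne'
    push_cast
    field_simp
    simp
  rw [h2] at h1
  have hzn : ‖(z : ℂ)‖ = t := by
    change ‖Complex.I * (t : ℂ)‖ = t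
    simp [abs_of_pos ht]
  rw [← h1, norm_mul, norm_zpow, hzn, zpow_neg, zpow_natCast]
  field_simp

open UpperHalfPlane ModularForm in
/-- A cusp form is small as `q → 1`, by the transformation `τ ↦ -1 / τ`. -/
lemma isCuspFormExpansion_mem_kerZalg {k : ℕ} {f : ℚ⟦X⟧} (hf : IsCuspFormExpansion k f) :
    f ∈ kerZalg k := by
  refine mem_kerZalg (isCuspFormExpansion_mem_FilMD hf) ?_
  obtain ⟨F, hF⟩ := hf
  have : Fact (IsCusp OnePoint.infty 𝒮ℒ) :=
    ⟨Subgroup.isCusp_of_mem_strictPeriods one_pos one_mem_strictPeriods_SL⟩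
  have h0 : Tendsto F atImInfty (𝓝 0) := CuspFormClass.zero_at_infty F
  rw [Metric.tendsto_nhds] at h0
  rw [Metric.tendsto_nhds]
  intro ε hε
  have hπ : 0 < 2 * Real.pi := by positivity
  have h1 := h0 (ε / (2 * Real.pi) ^ k) (by positivity)
  obtain ⟨A, hA⟩ := (atImInfty_mem _).mp h1
  have h2 : Tendsto (fun q : ℝ => -Real.log q / (2 * Real.pi)) (𝓝[<] 1) (𝓝 0) := by
    have : Tendsto (fun q : ℝ => -Real.log q / (2 * Real.pi)) (𝓝 1)
        (𝓝 (-Real.log 1 / (2 * Real.pi))) :=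
      ((Real.continuousAt_log one_ne_zero).neg.div_const _).tendsto
    rw [Real.log_one, neg_zero, zero_div] at this
    exact this.mono_left nhdsWithin_le_nhds
  have hA1 : (0 : ℝ) < (|A| + 1)⁻¹ := by positivity
  -- `q = exp (-2 π t)` with `t → 0`, so `i / t` is high up in the half plane
  filter_upwards [Ioo_mem_nhdsLT_one, h2.eventually (gt_mem_nhds hA1)] with q hq hqA
  set t := -Real.log q / (2 * Real.pi) with ht
  have ht0 : 0 < t := div_pos (neg_pos.mpr (Real.log_neg hq.1 hq.2)) hπ
  have hqt : Real.exp (-2 * Real.pi * t) = q := by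
    rw [ht, show -2 * Real.pi * (-Real.log q / (2 * Real.pi)) = Real.log q by field_simp,
      Real.exp_log hq.1]
  have h3 := hA ⟨Complex.I * (t⁻¹ : ℝ), by simpa using ht0⟩ (by
    change A ≤ (Complex.I * ((t⁻¹ : ℝ) : ℂ)).im
    rw [Complex.I_mul_im, Complex.ofReal_re]
    have h4 : |A| + 1 < t⁻¹ := (lt_inv_comm₀ ht0 (by positivity)).mp hqA
    linarith [le_abs_self A])
  rw [Set.mem_ofPred_eq, dist_zero_right, norm_cuspForm_inv F ht0, ← qEval_eq_cuspForm hF ht0, hqt,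
    Complex.norm_real, lt_div_iff₀ (by positivity)] at h3
  rw [dist_zero_right, norm_mul, norm_pow, Real.norm_of_nonneg (by linarith [hq.2] : 0 ≤ 1 - q)]
  have h5 : 1 - q ≤ 2 * Real.pi * t := by
    have := Real.add_one_le_exp (-2 * Real.pi * t)
    rw [hqt] at this
    linarith
  calc (1 - q) ^ k * ‖qEval f q‖ ≤ (2 * Real.pi * t) ^ k * ‖qEval f q‖ :=
        mul_le_mul_of_nonneg_right (pow_le_pow_left₀ (by linarith [hq.2]) h5 k) (norm_nonneg _)
    _ = t ^ k * ‖qEval f q‖ * (2 * Real.pi) ^ k := by rw [mul_pow]; ring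
    _ < ε := h3

end MultipleDivisorSums

open MultipleDivisorSums in
theorem theorem1p5 (k : ℕ) :
    -- the limits defining `Z_j` on `Fil^W_j(MDA)` exist
    (∀ j : ℕ, ∀ g ∈ FilMDA j,
      (∀ q ∈ Set.Ioo (0 : ℝ) 1, Summable fun n : ℕ => ((PowerSeries.coeff n g : ℚ) : ℝ) * q ^ n) ∧
      Tendsto (fun q : ℝ => (1 - q) ^ j * qEval g q) (𝓝[<] (1 : ℝ)) (𝓝 (Zmap j g))) ∧
    -- `Fil^W_k(MD)` consists of the sums `∑_{j ≤ k} g_j [1]^{k-j}` with `g_j ∈ Fil^W_j(MDA)`,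
    -- and `Z_k^alg` is a well-defined linear map
    (∀ f : PowerSeries ℚ, f ∈ FilMD k ↔ ∃ g : ℕ → PowerSeries ℚ, IsExpansion k f g) ∧
    (∀ (f : FilMD k) (g : ℕ → PowerSeries ℚ), IsExpansion k (f : PowerSeries ℚ) g →
      Zalg k f = ∑ j ∈ Finset.range (k + 1),
        Polynomial.C (Zmap j (g j)) * Polynomial.X ^ (k - j)) ∧
    IsLinearMap ℚ (Zalg k) ∧
    -- (i) brackets of weight less than `k`
    (∀ (l : ℕ) (s : Fin l → ℕ), (∀ j, 1 ≤ s j) → ∑ j, s j < k → bracket s ∈ kerZalg k) ∧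
    -- (ii) derivatives
    (2 ≤ k → ∀ f ∈ FilMD (k - 2), qDeriv f ∈ kerZalg k) ∧
    -- (iii) cusp forms
    (∀ f : PowerSeries ℚ, IsCuspFormExpansion k f → f ∈ kerZalg k) := by
  refine ⟨fun j g hg => ⟨fun q hq => ?_, tendsto_Zmap hg⟩, fun f => mem_FilMD_iff,
    fun f g hg => ?_, isLinearMap_Zalg k, fun l s hs hk => ?_,
    fun hk f hf => qDeriv_mem_kerZalg hk hf, fun f hf => isCuspFormExpansion_mem_kerZalg hf⟩
  · exact (convAt_of_mem_FilMD hq (FilMDA_le_FilMD j hg)).summable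
  · exact (isGrowthPoly_Zalg k f).unique (isGrowthPoly_of_isExpansion hg)
  · exact mem_kerZalg_of_mem_FilMD hk (bracket_mem_FilMD s hs)
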